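/- **Lemma (Amortized Test and Divide Partitioning).** Consider the following incremental algorithm $G$ for the Delaunay triangulation of a sequence $p_1,\dots,p_n$ of distinct planar points in general position (no three collinear, no four cocircular). The first three points are joined directly. For $i>3$, $G$ inserts $p_i$ into the Delaunay triangulation of $p_1,\dots,p_{i-1}$: it locates $p_i$ by walking along the straight segment from $p_{i-1}$ to $p_i$ (one *navigation operation* for each edge crossed), joins $p_i$ to the three vertices of the triangle that contains it (or, if $p_i$ is outside the convex hull, to the endpoints of all hull edges visible from it), and then flips invalid edges, i.e. edges violating the empty circumcircle condition, until the Delaunay triangulation of $p_1,\dots,p_i$ is reached (one *flip operation* for each flip). For an integer $k>0$, a sequence is *Amortized $k$-D-linear* if for every $i$ the algorithm $G$ performs in total at most $k\cdot i$ navigation and flip operations on its first $i$ points. An *Amortized D-linear run* of a sequence $S$ (for the fixed threshold $k$) is an Amortized $k$-D-linear block of consecutive points of $S$. The *amortized test and divide partitioning* of $S=\langle p_1,\dots,p_n\rangle$ outputs $S$ as a single run if $S$ is Amortized $k$-D-linear; otherwise it recursively partitions $\langle p_1,\dots,p_{\lfloor n/2\rfloor}\rangle$ and $\langle p_{\lfloor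 n/2\rfloor+1},\dots,p_n\rangle$. Then for every integer $k>0$ there is a family $(S_n)_n$, where $S_n$ is a sequence of $n$ distinct planar points in general position, such that the number of runs yielded by the amortized test and divide partitioning of $S_n$ is in $\Theta(n)$ as $n\to\infty$ (with constants that may depend on $k$), while for all sufficiently large $n$ the minimum number of runs in a partition of $S_n$ into Amortized D-linear runs is exactly $2$. -/

import Mathlib

open Filter Asymptotics

noncomputable section

/-- The Euclidean plane. -/
abbrev Plane : Type := EuclideanSpace ℝ (Fin 2)

/-- The points of the sequence are distinct, no three of them are collinear and no four of them
lie on a common circle. -/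
def InGeneralPosition (S : List Plane) : Prop :=
  S.Nodup ∧
  (∀ a ∈ S, ∀ b ∈ S, ∀ c ∈ S, a ≠ b → a ≠ c → b ≠ c → ¬ Collinear ℝ ({a, b, c} : Set Plane)) ∧
  (∀ a ∈ S, ∀ b ∈ S, ∀ c ∈ S, ∀ d ∈ S, a ≠ b → a ≠ c → a ≠ d → b ≠ c → b ≠ d → c ≠ d →
    ¬ EuclideanGeometry.Cospherical ({a, b, c, d} : Set Plane))

/-- `d` lies strictly inside the circle through the points of `t` (`t` is the vertex set of a
nondegenerate triangle, so there is exactly one such circle). -/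
def InCircumcircle (t : Set Plane) (d : Plane) : Prop :=
  ∃ (o : Plane) (r : ℝ), (∀ x ∈ t, dist x o = r) ∧ dist d o < r

/-- The Delaunay triangulation of the points of `P`. A triangle is represented by the set of its
three vertices and a triangulation by the set of its triangles; a triangle with vertices in `P`
is present exactly when no point of `P` is inside its circumcircle. -/
def delaunay (P : List Plane) : Set (Set Plane) :=
  {t | t.ncard = 3 ∧ (∀ x ∈ t, x ∈ P) ∧ ¬ Collinear ℝ t ∧ ∀ d ∈ P, ¬ InCircumcircle t d}

/-- The edges of the triangles of `T`, each represented by the set of its two endpoints. -/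
def edges (T : Set (Set Plane)) : Set (Set Plane) :=
  {e | e.ncard = 2 ∧ ∃ t ∈ T, e ⊆ t}

/-- The edges of `T` that are crossed by the straight walk from `q` to `p`. -/
def crossedEdges (T : Set (Set Plane)) (q p : Plane) : Set (Set Plane) :=
  {e | e ∈ edges T ∧ ∃ a b, e = {a, b} ∧ (openSegment ℝ a b ∩ openSegment ℝ q p).Nonempty}

/-- A boundary edge of `T`: an edge of exactly one triangle. -/
def IsBoundaryEdge (T : Set (Set Plane)) (e : Set Plane) : Prop :=
  ∃! t, t ∈ T ∧ e ⊆ t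

/-- The triangulation obtained from `T` by joining the new point `p` to the vertices of the
triangle that contains it. If `p` lies outside of the region covered by `T`, it is joined to the
endpoints of all boundary edges visible from `p`, that is, the boundary edges whose line strictly
separates `p` from the triangle they belong to. -/
def joinPoint (T : Set (Set Plane)) (p : Plane) : Set (Set Plane) :=
  {t | t ∈ T ∧ p ∉ convexHull ℝ t} ∪
  {s | ∃ a b c, ({a, b, c} : Set Plane) ∈ T ∧ s = {p, a, b} ∧
    (p ∈ convexHull ℝ ({a, b, c} : Set Plane) ∨
      (IsBoundaryEdge T {a, b} ∧ (line[ℝ, a, b]).SOppSide c p))}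

/-- One flip: an invalid edge `{a, b}`, shared by the triangles `{a, b, c}` and `{a, b, d}` with
`d` inside the circumcircle of `{a, b, c}`, is replaced by the edge `{c, d}`. -/
def Flip (T T' : Set (Set Plane)) : Prop :=
  ∃ a b c d : Plane, c ≠ d ∧ ({a, b, c} : Set Plane) ∈ T ∧ ({a, b, d} : Set Plane) ∈ T ∧
    InCircumcircle {a, b, c} d ∧
    T' = (T \ {{a, b, c}, {a, b, d}}) ∪ {{a, c, d}, {b, c, d}}

/-- `FlipSeq T r T'`: the triangulation `T` is transformed into `T'` by `r` flips. -/
inductive FlipSeq : Set (Set Plane) → ℕ → Set (Set Plane) → Prop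
  | refl (T : Set (Set Plane)) : FlipSeq T 0 T
  | step {T T' T'' : Set (Set Plane)} {r : ℕ} :
      Flip T T' → FlipSeq T' r T'' → FlipSeq T (r + 1) T''

/-- `InsertOps P p m`: when the incremental algorithm inserts `p` into the Delaunay triangulation
of the points of `P`, it performs `m` navigation and flip operations. The first three points are
joined directly. Later, the algorithm locates `p` by walking straight from the point `q` inserted
last towards `p` (one navigation operation for each edge crossed), joins `p` to the
triangulation, and flips invalid edges until the triangulation is Delaunay (one operation for each
flip). -/
def InsertOps (P : List Plane) (p : Plane) (m : ℕ) : Prop :=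
  (P.length < 3 ∧ m = 0) ∨
  (3 ≤ P.length ∧ ∃ (q : Plane) (r : ℕ), P.getLast? = some q ∧
    FlipSeq (joinPoint (delaunay P) p) r (delaunay (P ++ [p])) ∧
    m = (crossedEdges (delaunay P) q p).ncard + r)

/-- `Exec S m`: the incremental algorithm performs `m` navigation and flip operations in total
while it computes the Delaunay triangulation of `S`, inserting the points in the order of `S`. -/
inductive Exec : List Plane → ℕ → Prop
  | nil : Exec [] 0
  | snoc {P : List Plane} {p : Plane} {m r : ℕ} :
      Exec P m → InsertOps P p r → Exec (P ++ [p]) (m + r)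

/-- The sequence `S` is Amortized `k`-D-linear: for each `i`, the incremental algorithm performs
at most `k * i` operations on the first `i` points. -/
def AmortizedDLinear (k : ℕ) (S : List Plane) : Prop :=
  ∀ i ≤ S.length, ∃ m ≤ k * i, Exec (S.take i) m

open Classical in
/-- The amortized test and divide partitioning of `S`, as the list of the runs it identifies.
(Sequences with at most one point are always Amortized `k`-D-linear; the second disjunct only
makes the termination of the recursion evident.) -/
def testAndDivide (k : ℕ) (S : List Plane) : List (List Plane) :=
  if AmortizedDLinear k S ∨ S.length ≤ 1 then [S]
  else testAndDivide k (S.take (S.length / 2)) ++ testAndDivide k (S.drop (S.length / 2))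
termination_by S.length
decreasing_by
  all_goals
    simp only [List.length_take, List.length_drop]
    omega

/-- The possible numbers of runs in a partition of `S` into Amortized `k`-D-linear runs, i.e. into
nonempty blocks of consecutive points each of which is Amortized `k`-D-linear. -/
def runPartitionSizes (k : ℕ) (S : List Plane) : Set ℕ :=
  {m | ∃ Q : List (List Plane), Q.length = m ∧ Q.flatten = S ∧
    ∀ R ∈ Q, R ≠ [] ∧ AmortizedDLinear k R}

end

/-! All points lie on the parabola `y = x ^ 2` with positive abscissas. A circle through three such
points meets the parabola again at minus the sum of their abscissas, so only the order of the
abscissas decides the in-circle test, and the Delaunay triangulation is a fan from the leftmost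
point (`delaunay_map_pt`). The cost of an insertion becomes combinatorial: a walk crosses the spokes
to the points between its ends and at most one outer edge, and a new point right of the apex and of
at least one further point needs at most one flip (`card_le_of_insertOps`, `exists_insertOps_le`).

The sequence `hardSeq` has three phases. A long increasing phase is free and earns credit. A phase
of linear length then jumps back and forth at a cost per point that is constant but too large for
threshold `k`; the credit pays for it, yet no long block inside this phase is a run. Finally,
constantly many points alternate between the far left and the far right. By themselves they are
cheap, but after many other points each walk sweeps over all of those, so no long final segment of
the sequence is a run.

Cutting before the last phase gives two runs, and one is impossible. Test and divide instead cuts at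
midpoints: the part containing the end keeps failing the test, and the parts split off inside the
zigzag phase fail until they have bounded length. Hence linearly many runs
(`le_length_testAndDivide_of_suffix`). -/

/-! ### Circles and lines through points of the parabola. -/

/-- The point with abscissa `x` on the parabola `y = x ^ 2`. -/
noncomputable def pt (x : ℕ) : Plane := !₂[(x : ℝ), (x : ℝ) ^ 2]

@[simp] lemma pt_zero (x : ℕ) : pt x 0 = x := rfl

@[simp] lemma pt_one (x : ℕ) : pt x 1 = (x : ℝ) ^ 2 := rfl

lemma pt_injective : Function.Injective pt := fun x y h => by
  have := congrArg (fun z : Plane => z 0) h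
  simpa using this

@[simp] lemma pt_inj {x y : ℕ} : pt x = pt y ↔ x = y := pt_injective.eq_iff

lemma not_collinear_pt {a b c : ℕ} (hab : a ≠ b) (hac : a ≠ c) (hbc : b ≠ c) :
    ¬ Collinear ℝ ({pt a, pt b, pt c} : Set Plane) := by
  intro h
  rw [collinear_iff_of_mem (p₀ := pt a) (by simp)] at h
  obtain ⟨w, hw⟩ := h
  obtain ⟨r, hr⟩ := hw (pt b) (by simp)
  obtain ⟨s, hs⟩ := hw (pt c) (by simp)
  have r0 := congrArg (fun z : Plane => z 0) hr
  have r1 := congrArg (fun z : Plane => z 1) hr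
  have s0 := congrArg (fun z : Plane => z 0) hs
  have s1 := congrArg (fun z : Plane => z 1) hs
  simp at r0 r1 s0 s1
  have key : ((b : ℝ) - a) * (c - a) * (c - b) = 0 := by
    have e0 : (b : ℝ) - a = r * w 0 := by linarith
    have e1 : (b : ℝ) ^ 2 - a ^ 2 = r * w 1 := by linarith
    have f0 : (c : ℝ) - a = s * w 0 := by linarith
    have f1 : (c : ℝ) ^ 2 - a ^ 2 = s * w 1 := by linarith
    have : ((b : ℝ) - a) * (c ^ 2 - a ^ 2) = (c - a) * (b ^ 2 - a ^ 2) := by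
      rw [e0, e1, f0, f1]; ring
    linear_combination this
  have h1 : (b : ℝ) - a ≠ 0 := sub_ne_zero.2 (by exact_mod_cast hab.symm)
  have h2 : (c : ℝ) - a ≠ 0 := sub_ne_zero.2 (by exact_mod_cast hac.symm)
  have h3 : (c : ℝ) - b ≠ 0 := sub_ne_zero.2 (by exact_mod_cast hbc.symm)
  exact mul_ne_zero (mul_ne_zero h1 h2) h3 key

lemma dist_pt_sq (x : ℕ) (o : Plane) :
    dist (pt x) o ^ 2 = ((x : ℝ) - o 0) ^ 2 + ((x : ℝ) ^ 2 - o 1) ^ 2 := by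
  rw [EuclideanSpace.dist_eq, Real.sq_sqrt (by positivity)]
  simp [Fin.sum_univ_two, Real.dist_eq, sq_abs]

/-- The power of the fourth point of the parabola with respect to the circle through three others. -/
lemma power_of_pt {a b c : ℕ} (hab : a ≠ b) (hac : a ≠ c) (hbc : b ≠ c) {o : Plane} {r : ℝ}
    (ha : dist (pt a) o = r) (hb : dist (pt b) o = r) (hc : dist (pt c) o = r) (d : ℕ) :
    dist (pt d) o ^ 2 - r ^ 2 =
      ((d : ℝ) - a) * (d - b) * (d - c) * (d + a + b + c) := by
  have ea := dist_pt_sq a o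
  have eb := dist_pt_sq b o
  have ec := dist_pt_sq c o
  rw [ha] at ea
  rw [hb] at eb
  rw [hc] at ec
  rw [dist_pt_sq]
  have h1 : (a : ℝ) - b ≠ 0 := sub_ne_zero.2 (by exact_mod_cast hab)
  have h2 : (a : ℝ) - c ≠ 0 := sub_ne_zero.2 (by exact_mod_cast hac)
  have h3 : (b : ℝ) - c ≠ 0 := sub_ne_zero.2 (by exact_mod_cast hbc)
  generalize o 0 = u at *
  generalize o 1 = v at *
  generalize (a : ℝ) = a at *
  generalize (b : ℝ) = b at *
  generalize (c : ℝ) = c at *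
  generalize (d : ℝ) = d at *
  -- The circle equations divided by differences of abscissas: `k1` and `k2` are first divided
  -- differences, `k3` the second. They eliminate the centre `(u, v)`.
  have k1 : a + b - 2 * u + (a ^ 2 + b ^ 2 - 2 * v) * (a + b) = 0 := by
    apply mul_left_cancel₀ h1; linear_combination eb - ea
  have k2 : a + c - 2 * u + (a ^ 2 + c ^ 2 - 2 * v) * (a + c) = 0 := by
    apply mul_left_cancel₀ h2; linear_combination ec - ea
  have k3 : 1 + a ^ 2 + b ^ 2 + c ^ 2 + a * b + b * c + c * a - 2 * v = 0 := by
    apply mul_left_cancel₀ h3; linear_combination k1 - k2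
  linear_combination (d - a) * k1 + (d - a) * (d - b) * k3 - ea

/-- Positivity of the abscissas makes the factor `d + a + b + c` of the power positive, so the cubic
alone fixes the sign. -/
lemma inCircumcircle_pt {a b c d : ℕ} (ha : 0 < a) (hab : a ≠ b) (hac : a ≠ c) (hbc : b ≠ c) :
    InCircumcircle {pt a, pt b, pt c} (pt d) ↔
      ((d : ℝ) - a) * (d - b) * (d - c) < 0 := by
  have hpos : (0 : ℝ) < d + a + b + c := by positivity
  constructor
  · rintro ⟨o, r, h, hd⟩
    have key := power_of_pt hab hac hbc (h _ (by simp)) (h _ (by simp)) (h _ (by simp)) d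
    have : dist (pt d) o ^ 2 < r ^ 2 := by gcongr
    by_contra hn
    have := mul_nonneg (not_lt.1 hn) hpos.le
    linarith
  · intro hd
    -- The centre is obtained by solving `k3` and then `k1` from the proof of `power_of_pt`.
    set v : ℝ := (1 + a ^ 2 + b ^ 2 + c ^ 2 + a * b + b * c + c * a) / 2 with hv
    set u : ℝ := (a + b) * (1 + a ^ 2 + b ^ 2 - 2 * v) / 2 with hu
    have hx : ∀ x : ℕ, x = a ∨ x = b ∨ x = c →
        dist (pt x) !₂[u, v] = dist (pt a) !₂[u, v] := by
      intro x hx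
      rw [← sq_eq_sq₀ dist_nonneg dist_nonneg, dist_pt_sq, dist_pt_sq]
      rcases hx with rfl | rfl | rfl <;> simp [hu, hv] <;> ring
    refine ⟨!₂[u, v], dist (pt a) !₂[u, v], ?_, ?_⟩
    · rintro x (rfl | rfl | rfl) <;> exact hx _ (by simp)
    · have key := power_of_pt hab hac hbc rfl (hx b (by simp)) (hx c (by simp)) d
      have := mul_neg_of_neg_of_pos hd hpos
      exact lt_of_pow_lt_pow_left₀ 2 dist_nonneg (by linarith)

lemma inCircumcircle_pt_of_lt {a b c d : ℕ} (ha : 0 < a) (hab : a < b) (hbc : b < c) :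
    InCircumcircle {pt a, pt b, pt c} (pt d) ↔ d < a ∨ (b < d ∧ d < c) := by
  rw [inCircumcircle_pt ha hab.ne (hab.trans hbc).ne hbc.ne]
  have hab' : (a : ℝ) < b := by exact_mod_cast hab
  have hbc' : (b : ℝ) < c := by exact_mod_cast hbc
  constructor
  · intro h
    by_contra! hn
    obtain ⟨h1, h2⟩ := hn
    have h1' : (a : ℝ) ≤ d := by exact_mod_cast h1
    rcases le_or_gt d b with hdb | hdb
    · have hdb' : (d : ℝ) ≤ b := by exact_mod_cast hdb
      have := mul_nonneg (mul_nonneg (sub_nonneg.2 h1') (sub_nonneg.2 hdb'))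
        (by linarith : (0 : ℝ) ≤ c - d)
      linarith
    · have hdc' : (c : ℝ) ≤ d := by exact_mod_cast h2 hdb
      have := mul_nonneg (mul_nonneg (sub_nonneg.2 h1') (by linarith : (0 : ℝ) ≤ d - b))
        (sub_nonneg.2 hdc')
      linarith
  · rintro (h | ⟨h1, h2⟩)
    · have h' : (d : ℝ) < a := by exact_mod_cast h
      exact mul_neg_of_pos_of_neg (mul_pos_of_neg_of_neg (by linarith) (by linarith))
        (by linarith)
    · have h1' : (b : ℝ) < d := by exact_mod_cast h1
      have h2' : (d : ℝ) < c := by exact_mod_cast h2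
      exact mul_neg_of_pos_of_neg (mul_pos (by linarith) (by linarith)) (by linarith)

lemma inGeneralPosition_map_pt {l : List ℕ} (hl : l.Nodup) (hpos : ∀ x ∈ l, 0 < x) :
    InGeneralPosition (l.map pt) := by
  refine ⟨hl.map pt_injective, ?_, ?_⟩
  · simp only [List.mem_map]
    rintro _ ⟨a, -, rfl⟩ _ ⟨b, -, rfl⟩ _ ⟨c, -, rfl⟩ hab hac hbc
    exact not_collinear_pt (by simpa using hab) (by simpa using hac) (by simpa using hbc)
  · simp only [List.mem_map]
    rintro _ ⟨a, ha, rfl⟩ _ ⟨b, -, rfl⟩ _ ⟨c, -, rfl⟩ _ ⟨d, -, rfl⟩ hab hac had hbc hbd hcd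
    rintro ⟨o, r, h⟩
    have key := power_of_pt (by simpa using hab) (by simpa using hac) (by simpa using hbc)
      (h _ (by simp)) (h _ (by simp)) (h _ (by simp)) d
    rw [h (pt d) (by simp), sub_self] at key
    have h1 : (d : ℝ) - a ≠ 0 := sub_ne_zero.2 (by simpa [eq_comm] using had)
    have h2 : (d : ℝ) - b ≠ 0 := sub_ne_zero.2 (by simpa [eq_comm] using hbd)
    have h3 : (d : ℝ) - c ≠ 0 := sub_ne_zero.2 (by simpa [eq_comm] using hcd)
    have h4 : (d : ℝ) + a + b + c ≠ 0 := by
      have := hpos a ha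
      positivity
    exact mul_ne_zero (mul_ne_zero (mul_ne_zero h1 h2) h3) h4 key.symm

/-! ### The Delaunay triangulation as a fan. -/

/-- The triangles joining `h` to two consecutive elements of `l`, on the parabola. -/
def fan (l : List ℕ) (h : ℕ) : Set (Set Plane) :=
  {t | ∃ u v, u ∈ l ∧ v ∈ l ∧ h < u ∧ u < v ∧ (∀ w ∈ l, ¬ (u < w ∧ w < v)) ∧
    t = {pt h, pt u, pt v}}

lemma exists_sorted_triple {a b c : ℕ} (hab : a ≠ b) (hac : a ≠ c) (hbc : b ≠ c) :
    ∃ u v w, u < v ∧ v < w ∧ ({pt a, pt b, pt c} : Set Plane) = {pt u, pt v, pt w} := by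
  rcases lt_or_gt_of_ne hab with h1 | h1 <;> rcases lt_or_gt_of_ne hac with h2 | h2 <;>
    rcases lt_or_gt_of_ne hbc with h3 | h3
  · exact ⟨a, b, c, h1, h3, rfl⟩
  · exact ⟨a, c, b, h2, h3, by grind⟩
  · omega
  · exact ⟨c, a, b, h2, h1, by grind⟩
  · exact ⟨b, a, c, h1, h2, by grind⟩
  · omega
  · exact ⟨b, c, a, h3, h2, by grind⟩
  · exact ⟨c, b, a, h3, h1, by grind⟩

/-- For `a < b < c` the circumcircle contains exactly the points left of `a` and those between `b`
and `c`; it is empty iff `a` is the minimum and `b`, `c` are neighbours. -/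
lemma delaunay_map_pt {l : List ℕ} {h : ℕ} (hh : h ∈ l) (hmin : ∀ x ∈ l, h ≤ x) (h0 : 0 < h) :
    delaunay (l.map pt) = fan l h := by
  ext t
  constructor
  · rintro ⟨hcard, hmem, -, hempty⟩
    obtain ⟨x, y, z, hxy, hxz, hyz, rfl⟩ := Set.ncard_eq_three.1 hcard
    obtain ⟨a, -, rfl⟩ := List.mem_map.1 (hmem x (by simp))
    obtain ⟨b, -, rfl⟩ := List.mem_map.1 (hmem y (by simp))
    obtain ⟨c, -, rfl⟩ := List.mem_map.1 (hmem z (by simp))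
    obtain ⟨u, v, w, huv, hvw, e⟩ := exists_sorted_triple (by simpa using hxy)
      (by simpa using hxz) (by simpa using hyz)
    rw [e] at hmem hempty ⊢
    have hu : u ∈ l := by simpa using hmem (pt u) (by simp)
    have hv : v ∈ l := by simpa using hmem (pt v) (by simp)
    have hw : w ∈ l := by simpa using hmem (pt w) (by simp)
    have key : ∀ d ∈ l, ¬ (d < u ∨ (v < d ∧ d < w)) := fun d hd => by
      rw [← inCircumcircle_pt_of_lt (by have := hmin u hu; omega) huv hvw]
      exact hempty _ (List.mem_map_of_mem hd)
    obtain rfl : h = u := by have := hmin u hu; have := key h hh; omega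
    exact ⟨v, w, hv, hw, huv, hvw, fun d hd => by have := key d hd; tauto, rfl⟩
  · rintro ⟨u, v, hu, hv, hhu, huv, hcons, rfl⟩
    have n1 : h ≠ u := hhu.ne
    have n2 : h ≠ v := by omega
    have n3 : u ≠ v := huv.ne
    refine ⟨Set.ncard_eq_three.2 ⟨_, _, _, by simpa using n1, by simpa using n2,
      by simpa using n3, rfl⟩, ?_, not_collinear_pt n1 n2 n3, ?_⟩
    · rintro x (rfl | rfl | rfl) <;> simpa
    · simp only [List.mem_map]
      rintro _ ⟨d, hd, rfl⟩
      rw [inCircumcircle_pt_of_lt h0 hhu huv]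
      have := hmin d hd
      have := hcons d hd
      omega

/-! ### Chords of the parabola: sides, convexity and crossings. -/

/-- The affine form vanishing on the line through the points of the parabola with abscissas
`a` and `b`. -/
def chordForm (a b : ℝ) (z : Plane) : ℝ := z 1 - (a + b) * z 0 + a * b

lemma chordForm_pt (a b : ℝ) (x : ℕ) : chordForm a b (pt x) = (x - a) * (x - b) := by
  simp [chordForm]; ring

lemma mem_line_pt_iff {a b : ℕ} (hab : a ≠ b) (z : Plane) :
    z ∈ line[ℝ, pt a, pt b] ↔ chordForm a b z = 0 := by
  have h : (b : ℝ) - a ≠ 0 := sub_ne_zero.2 (by exact_mod_cast hab.symm)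
  rw [mem_affineSpan_pair_iff_exists_lineMap_eq]
  constructor
  · rintro ⟨r, rfl⟩
    simp [chordForm, AffineMap.lineMap_apply]
    ring
  · intro hz
    refine ⟨(z 0 - a) / (b - a), ?_⟩
    simp only [chordForm] at hz
    ext i
    fin_cases i
    · simp [AffineMap.lineMap_apply]
      field_simp
      ring
    · simp [AffineMap.lineMap_apply]
      field_simp
      linear_combination -((b : ℝ) - a) * hz

lemma sOppSide_line_pt_iff {a b : ℕ} (hab : a ≠ b) (x y : ℕ) :
    (line[ℝ, pt a, pt b]).SOppSide (pt x) (pt y) ↔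
      ((x : ℝ) - a) * (x - b) * (((y : ℝ) - a) * (y - b)) < 0 := by
  rw [← chordForm_pt, ← chordForm_pt]
  constructor
  · intro h
    obtain ⟨p, hp, hs⟩ := h.exists_sbtw
    have hx := h.left_notMem
    have hy := h.right_notMem
    rw [mem_line_pt_iff hab] at hp hx hy
    obtain ⟨⟨r, ⟨hr0, hr1⟩, rfl⟩, h1, h2⟩ := hs
    have e : (1 - r) * chordForm a b (pt x) + r * chordForm a b (pt y) = 0 := by
      rw [← hp]
      simp [chordForm, AffineMap.lineMap_apply]
      ring
    have hr0' : r ≠ 0 := fun h0 => h1 (by simp [h0])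
    have hr1' : r ≠ 1 := fun h0 => h2 (by simp [h0])
    have hr0 := lt_of_le_of_ne hr0 hr0'.symm
    have hr1 := lt_of_le_of_ne hr1 hr1'
    have e2 : (1 - r) * (chordForm a b (pt x) * chordForm a b (pt y)) =
      - (r * (chordForm a b (pt y)) ^ 2) := by
      linear_combination chordForm a b (pt y) * e
    have : 0 < r * (chordForm a b (pt y)) ^ 2 := by positivity
    by_contra hn
    have := mul_nonneg (by linarith : 0 ≤ 1 - r) (not_lt.1 hn)
    linarith
  · intro h
    -- Projecting vertically onto the chord shows that `chordForm` is the signed vertical offset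
    -- from it, so opposite signs mean opposite sides.
    have key : ∀ z : Plane, z - chordForm a b z • (!₂[0, 1] : Plane) ∈ line[ℝ, pt a, pt b] := by
      intro z
      rw [mem_line_pt_iff hab]
      simp [chordForm]
      ring
    refine AffineSubspace.sOppSide_of_vsub_eq_smul (m := !₂[0, 1]) (key (pt x)) (key (pt y))
      (c₁ := chordForm a b (pt x)) (c₂ := chordForm a b (pt y)) (by simp) (by simp) h.le ?_ ?_
    · rw [mem_line_pt_iff hab]
      intro h0
      simp [h0] at h
    · rw [mem_line_pt_iff hab]
      intro h0
      simp [h0] at h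

/-- The tangent at `pt p`, the zero set of `chordForm p p`, has every other point of the parabola
strictly above it. -/
lemma pt_notMem_convexHull {a b c p : ℕ} (ha : p ≠ a) (hb : p ≠ b) (hc : p ≠ c) :
    pt p ∉ convexHull ℝ ({pt a, pt b, pt c} : Set Plane) := by
  intro h
  have hconv : Convex ℝ {z : Plane | 0 < chordForm p p z} := by
    intro x hx y hy s t hs ht hst
    simp only [Set.mem_ofPred_eq, chordForm] at *
    simp only [PiLp.add_apply, PiLp.smul_apply, smul_eq_mul]
    have e : s * x 1 + t * y 1 - ((p : ℝ) + p) * (s * x 0 + t * y 0) + p * p =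
        s * (x 1 - (p + p) * x 0 + p * p) + t * (y 1 - (p + p) * y 0 + p * p) := by
      linear_combination (-(p : ℝ) * p) * hst
    rw [e]
    rcases hs.eq_or_lt with rfl | hs
    · obtain rfl : t = 1 := by linarith
      simpa using hy
    · have := mul_pos hs hx
      have := mul_nonneg ht hy.le
      linarith
  have hsub : ({pt a, pt b, pt c} : Set Plane) ⊆ {z : Plane | 0 < chordForm p p z} := by
    have aux : ∀ x : ℕ, p ≠ x → 0 < chordForm p p (pt x) := fun x hx => by
      rw [chordForm_pt]
      exact mul_self_pos.2 (sub_ne_zero.2 (by exact_mod_cast hx.symm))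
    rintro _ (rfl | rfl | rfl)
    exacts [aux _ ha, aux _ hb, aux _ hc]
  have := convexHull_min hsub hconv h
  simp [chordForm_pt] at this

lemma openSegment_pt_iff {a b : ℕ} (hab : a < b) (z : Plane) :
    z ∈ openSegment ℝ (pt a) (pt b) ↔ (a : ℝ) < z 0 ∧ z 0 < b ∧ chordForm a b z = 0 := by
  have h : (0 : ℝ) < b - a := sub_pos.2 (by exact_mod_cast hab)
  constructor
  · rintro ⟨s, t, hs, ht, hst, rfl⟩
    obtain rfl : s = 1 - t := by linarith
    refine ⟨?_, ?_, ?_⟩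
    · simp
      nlinarith
    · simp
      nlinarith
    · simp [chordForm]
      ring
  · rintro ⟨h1, h2, h3⟩
    refine ⟨(b - z 0) / (b - a), (z 0 - a) / (b - a), div_pos (by linarith) h,
      div_pos (by linarith) h, by field_simp; ring, ?_⟩
    simp only [chordForm] at h3
    have h' := h.ne'
    ext i
    fin_cases i
    · simp
      field_simp
      ring
    · simp
      field_simp
      linear_combination -((b : ℝ) - a) * h3

lemma openSegment_inter_nonempty {a b q p : ℕ} (h1 : a < q) (h2 : q < b) (h3 : b < p) :
    (openSegment ℝ (pt a) (pt b) ∩ openSegment ℝ (pt q) (pt p)).Nonempty := by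
  have h1' : (a : ℝ) < q := by exact_mod_cast h1
  have h2' : (q : ℝ) < b := by exact_mod_cast h2
  have h3' : (b : ℝ) < p := by exact_mod_cast h3
  have hD : (0 : ℝ) < q + p - a - b := by linarith
  set x : ℝ := ((q : ℝ) * p - a * b) / (q + p - a - b) with hx
  have ex : x * (q + p - a - b) = q * p - a * b := div_mul_cancel₀ _ hD.ne'
  have hqx : (q : ℝ) < x := by
    rw [hx, lt_div_iff₀ hD]
    nlinarith
  have hxb : x < b := by
    rw [hx, div_lt_iff₀ hD]
    nlinarith
  refine ⟨!₂[x, (a + b) * x - a * b], ?_, ?_⟩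
  · rw [openSegment_pt_iff (h1.trans h2)]
    refine ⟨?_, ?_, ?_⟩
    · simp; linarith
    · simpa using hxb
    · simp [chordForm]
  · rw [openSegment_pt_iff (h2.trans h3)]
    refine ⟨?_, ?_, ?_⟩
    · simpa using hqx
    · simp; linarith
    · simp [chordForm]
      linarith

/-- At a common abscissa `x`, a chord lies `(x - a) * (b - x)` above the parabola; distinct nested
intervals give different heights. -/
lemma interlace_of_openSegment_inter {a b q p : ℕ} (hab : a < b) (hqp : q < p)
    (hne : ¬ (a = q ∧ b = p))
    (h : (openSegment ℝ (pt a) (pt b) ∩ openSegment ℝ (pt q) (pt p)).Nonempty) :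
    (a < q ∧ q < b ∧ b < p) ∨ (q < a ∧ a < p ∧ p < b) := by
  obtain ⟨z, hz1, hz2⟩ := h
  rw [openSegment_pt_iff hab] at hz1
  rw [openSegment_pt_iff hqp] at hz2
  obtain ⟨a1, a2, a3⟩ := hz1
  obtain ⟨b1, b2, b3⟩ := hz2
  simp only [chordForm] at a3 b3
  have e : (z 0 - a) * (b - z 0) = (z 0 - q) * (p - z 0) := by linear_combination b3 - a3
  have hqb : q < b := by exact_mod_cast b1.trans a2
  have hap : a < p := by exact_mod_cast a1.trans b2
  have aux : ∀ a b q p : ℕ, (a : ℝ) < z 0 → z 0 < b → (q : ℝ) < z 0 → z 0 < p →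
      (z 0 - a) * (b - z 0) = (z 0 - q) * (p - z 0) → a ≤ q → p ≤ b → a = q ∧ b = p := by
    intro a b q p a1 a2 b1 b2 e h1 h2
    have h1' : (a : ℝ) ≤ q := by exact_mod_cast h1
    have h2' : (p : ℝ) ≤ b := by exact_mod_cast h2
    constructor
    · by_contra hn
      have : (a : ℝ) < q := by exact_mod_cast lt_of_le_of_ne h1 hn
      nlinarith
    · by_contra hn
      have : (p : ℝ) < b := by exact_mod_cast lt_of_le_of_ne h2 (Ne.symm hn)
      nlinarith
  have c1 := aux a b q p a1 a2 b1 b2 e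
  have c2 := aux q p a b b1 b2 a1 a2 e.symm
  omega

/-! ### Edges of a fan and the navigation cost. -/

lemma exists_succ_mem {l : List ℕ} {x y : ℕ} (hy : y ∈ l) (hxy : x < y) :
    ∃ v ∈ l, x < v ∧ v ≤ y ∧ ∀ w ∈ l, ¬ (x < w ∧ w < v) := by
  classical
  have hex : ∃ v, v ∈ l ∧ x < v := ⟨y, hy, hxy⟩
  exact ⟨Nat.find hex, (Nat.find_spec hex).1, (Nat.find_spec hex).2, Nat.find_min' hex ⟨hy, hxy⟩,
    fun w hw hn => Nat.find_min hex hn.2 ⟨hw, hn.1⟩⟩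

lemma exists_pred_mem {l : List ℕ} {x y : ℕ} (hy : y ∈ l) (hyx : y < x) :
    ∃ v ∈ l, v < x ∧ y ≤ v ∧ ∀ w ∈ l, ¬ (v < w ∧ w < x) := by
  obtain ⟨v, hv, hmax⟩ := (l.toFinset.filter (· < x)).exists_max_image id
    ⟨y, by simp [hy, hyx]⟩
  simp only [Finset.mem_filter, List.mem_toFinset, id] at hv hmax
  refine ⟨v, hv.1, hv.2, hmax y ⟨hy, hyx⟩, fun w hw hn => ?_⟩
  have := hmax w ⟨hw, hn.2⟩
  omega

lemma exists_mem_fan {l : List ℕ} {h x y : ℕ} (hx : x ∈ l) (hy : y ∈ l) (hhx : h < x)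
    (hhy : h < y) (hxy : x ≠ y) : ∃ t ∈ fan l h, ({pt h, pt x} : Set Plane) ⊆ t := by
  rcases lt_or_gt_of_ne hxy with hlt | hlt
  · obtain ⟨v, hv, h1, -, h3⟩ := exists_succ_mem hy hlt
    exact ⟨_, ⟨x, v, hx, hv, hhx, h1, h3, rfl⟩, by grind⟩
  · obtain ⟨v, hv, h1, h2, h3⟩ := exists_pred_mem hy hlt
    exact ⟨_, ⟨v, x, hv, hx, by omega, h1, h3, rfl⟩, by grind⟩

lemma mem_edges_fan {l : List ℕ} {h : ℕ} {e : Set Plane} (he : e ∈ edges (fan l h)) :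
    (∃ x ∈ l, h < x ∧ e = {pt h, pt x}) ∨
    (∃ u v, u ∈ l ∧ v ∈ l ∧ h < u ∧ u < v ∧ (∀ w ∈ l, ¬ (u < w ∧ w < v)) ∧
      e = {pt u, pt v}) := by
  obtain ⟨hc, t, ⟨u, v, hu, hv, h1, h2, h3, rfl⟩, hsub⟩ := he
  obtain ⟨x, y, hxy, rfl⟩ := Set.ncard_eq_two.1 hc
  have hx : x ∈ ({pt h, pt u, pt v} : Set Plane) := hsub (by simp)
  have hy : y ∈ ({pt h, pt u, pt v} : Set Plane) := hsub (by simp)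
  rcases hx with rfl | rfl | rfl <;> rcases hy with rfl | rfl | rfl
  · exact absurd rfl hxy
  · exact Or.inl ⟨u, hu, h1, rfl⟩
  · exact Or.inl ⟨v, hv, by omega, rfl⟩
  · exact Or.inl ⟨u, hu, h1, Set.pair_comm _ _⟩
  · exact absurd rfl hxy
  · exact Or.inr ⟨u, v, hu, hv, h1, h2, h3, rfl⟩
  · exact Or.inl ⟨v, hv, by omega, Set.pair_comm _ _⟩
  · exact Or.inr ⟨u, v, hu, hv, h1, h2, h3, Set.pair_comm _ _⟩
  · exact absurd rfl hxy

lemma openSegment_pair_eq {x y a b : Plane} (h : ({x, y} : Set Plane) = {a, b}) :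
    openSegment ℝ x y = openSegment ℝ a b := by
  rcases Set.pair_eq_pair_iff.1 h with ⟨rfl, rfl⟩ | ⟨rfl, rfl⟩
  · rfl
  · exact openSegment_symm _ _ _

lemma openSegment_pt_min_max (q p : ℕ) :
    openSegment ℝ (pt q) (pt p) = openSegment ℝ (pt (min q p)) (pt (max q p)) := by
  rcases le_total q p with h | h
  · simp [h]
  · simp [h, openSegment_symm]

lemma finite_edges_fan (l : List ℕ) (h : ℕ) : (edges (fan l h)).Finite := by
  apply Set.Finite.subset (s := 𝒫 (insert (pt h) (pt '' {x | x ∈ l})))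
  · exact Set.Finite.finite_subsets (((List.finite_toSet l).image pt).insert _)
  · rintro e ⟨-, t, ⟨u, v, hu, hv, -, -, -, rfl⟩, hsub⟩
    refine hsub.trans ?_
    rintro _ (rfl | rfl | rfl)
    · simp
    · exact Or.inr ⟨_, hu, rfl⟩
    · exact Or.inr ⟨_, hv, rfl⟩

/-- A walk between two points crosses the fan edges ending strictly between them. -/
lemma card_between_le_ncard_crossedEdges {l : List ℕ} {h q p : ℕ} (hql : q ∈ l) (hq : h < q)
    (hp : h < p) (B : Finset ℕ) (hB : ∀ x ∈ B, x ∈ l ∧ min q p < x ∧ x < max q p) :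
    B.card ≤ (crossedEdges (fan l h) (pt q) (pt p)).ncard := by
  have hinj : Set.InjOn (fun x : ℕ => ({pt h, pt x} : Set Plane)) (B : Set ℕ) := by
    intro x hx y hy e
    rcases Set.pair_eq_pair_iff.1 e with ⟨-, e⟩ | ⟨e, -⟩
    · simpa using e
    · have := pt_inj.1 e
      have := hB y hy
      omega
  rw [← Set.ncard_coe_finset, ← hinj.ncard_image]
  refine Set.ncard_le_ncard ?_ ((finite_edges_fan l h).subset fun e he => he.1)
  rintro _ ⟨x, hx, rfl⟩
  obtain ⟨hxl, h1, h2⟩ := hB x hx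
  obtain ⟨t, ht, hsub⟩ := exists_mem_fan (h := h) hxl hql (by omega) hq (by omega)
  refine ⟨⟨Set.ncard_pair (by simp; omega), t, ht, hsub⟩, pt h, pt x, rfl, ?_⟩
  rw [openSegment_pt_min_max q p]
  exact openSegment_inter_nonempty (by omega) h1 h2

/-- A walk crosses at most twice as many edges as there are points between its ends. -/
lemma ncard_crossedEdges_le {l : List ℕ} {h q p : ℕ} (hmin : ∀ x ∈ l, h ≤ x)
    (hql : q ∈ l) (hpl : p ∉ l) (hp : h < p) (B : Finset ℕ)
    (hB : ∀ x ∈ l, min q p < x → x < max q p → x ∈ B) :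
    (crossedEdges (fan l h) (pt q) (pt p)).ncard ≤ 2 * B.card := by
  classical
  have hqp : q ≠ p := fun e => hpl (e ▸ hql)
  have hhq := hmin q hql
  -- An outer edge joins neighbours, so `q` is not strictly between its ends; to be crossed it must
  -- span the gap containing `p`, and there is only one such gap.
  set H : Set (Set Plane) := {e | ∃ u v, u ∈ l ∧ v ∈ l ∧ u < p ∧ p < v ∧
      (∀ w ∈ l, ¬ (u < w ∧ w < v)) ∧ e = {pt u, pt v}} with hH
  have hHs : H.Subsingleton := by
    rintro _ ⟨u, v, hu, hv, h1, h2, h3, rfl⟩ _ ⟨u', v', hu', hv', h1', h2', h3', rfl⟩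
    have := h3 u' hu'
    have := h3 v' hv'
    have := h3' u hu
    have := h3' v hv
    obtain rfl : u = u' := by omega
    obtain rfl : v = v' := by omega
    rfl
  have key : ∀ e ∈ crossedEdges (fan l h) (pt q) (pt p), B.Nonempty ∧
      e ∈ (fun x : ℕ => ({pt h, pt x} : Set Plane)) '' (B : Set ℕ) ∪ H := by
    rintro e ⟨he, x, y, rfl, hne⟩
    rcases mem_edges_fan he with ⟨z, hz, hhz, e⟩ | ⟨u, v, hu, hv, h1, h2, h3, e⟩
    · rw [openSegment_pair_eq e, openSegment_pt_min_max q p] at hne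
      have := interlace_of_openSegment_inter hhz (by omega)
        (by rintro ⟨e1, e2⟩; have : z ≠ p := (fun h => hpl (h ▸ hz)); omega) hne
      have hzB := hB z hz (by omega) (by omega)
      exact ⟨⟨z, hzB⟩, Or.inl ⟨z, hzB, e.symm⟩⟩
    · rw [openSegment_pair_eq e, openSegment_pt_min_max q p] at hne
      have := interlace_of_openSegment_inter h2 (by omega)
        (by
          rintro ⟨e1, e2⟩
          have : u ≠ p := (fun h => hpl (h ▸ hu))
          have : v ≠ p := (fun h => hpl (h ▸ hv))
          omega) hne
      have := h3 q hql
      refine ⟨?_, Or.inr ⟨u, v, hu, hv, by omega, by omega, h3, e⟩⟩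
      by_cases huB : min q p < u ∧ u < max q p
      · exact ⟨u, hB u hu huB.1 huB.2⟩
      · exact ⟨v, hB v hv (by omega) (by omega)⟩
  rcases (crossedEdges (fan l h) (pt q) (pt p)).eq_empty_or_nonempty with h0 | ⟨e, he⟩
  · simp [h0]
  · have hBpos := (key e he).1.card_pos
    calc (crossedEdges (fan l h) (pt q) (pt p)).ncard
        ≤ ((fun x : ℕ => ({pt h, pt x} : Set Plane)) '' (B : Set ℕ) ∪ H).ncard :=
          Set.ncard_le_ncard (fun e he => (key e he).2)
            ((B.finite_toSet.image _).union hHs.finite)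
      _ ≤ ((fun x : ℕ => ({pt h, pt x} : Set Plane)) '' (B : Set ℕ)).ncard + H.ncard :=
          Set.ncard_union_le _ _
      _ ≤ B.card + 1 := by
          gcongr
          · exact (Set.ncard_image_le B.finite_toSet).trans (Set.ncard_coe_finset B).le
          · exact (Set.ncard_le_one hHs.finite).2 fun a ha b hb => hHs ha hb
      -- The extra outer edge is absorbed because a crossing forces `B` to be nonempty. For empty
      -- `B` the bound is thus zero, which the cheap phases need.
      _ ≤ 2 * B.card := by omega

/-! ### Boundary edges, visibility and flips. -/

lemma triple_eq_cases {A B C X Y Z : Plane} (hXY : X ≠ Y) (hXZ : X ≠ Z) (hYZ : Y ≠ Z)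
    (e : ({A, B, C} : Set Plane) = {X, Y, Z}) :
    (C = X ∧ ({A, B} : Set Plane) = {Y, Z}) ∨ (C = Y ∧ ({A, B} : Set Plane) = {X, Z}) ∨
      (C = Z ∧ ({A, B} : Set Plane) = {X, Y}) := by
  have hA : A ∈ ({X, Y, Z} : Set Plane) := e ▸ by simp
  have hB : B ∈ ({X, Y, Z} : Set Plane) := e ▸ by simp
  have hC : C ∈ ({X, Y, Z} : Set Plane) := e ▸ by simp
  have hX : X ∈ ({A, B, C} : Set Plane) := e ▸ by simp
  have hY : Y ∈ ({A, B, C} : Set Plane) := e ▸ by simp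
  have hZ : Z ∈ ({A, B, C} : Set Plane) := e ▸ by simp
  simp only [Set.mem_insert_iff, Set.mem_singleton_iff] at hA hB hC hX hY hZ
  simp only [Set.pair_eq_pair_iff]
  grind

lemma triple_pt_inj {h u v u' v' : ℕ} (h1 : h < u) (h2 : u < v) (h1' : h < u') (h2' : u' < v')
    (e : ({pt h, pt u, pt v} : Set Plane) = {pt h, pt u', pt v'}) : u = u' ∧ v = v' := by
  have a1 : pt u ∈ ({pt h, pt u', pt v'} : Set Plane) := e ▸ by simp
  have a2 : pt v ∈ ({pt h, pt u', pt v'} : Set Plane) := e ▸ by simp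
  have a3 : pt u' ∈ ({pt h, pt u, pt v} : Set Plane) := e ▸ by simp
  simp only [Set.mem_insert_iff, Set.mem_singleton_iff, pt_inj] at a1 a2 a3
  omega

lemma fan_pair_subset_cases {l : List ℕ} {h x y : ℕ} {t : Set Plane} (ht : t ∈ fan l h)
    (hx : h < x) (hxy : x < y) (hsub : ({pt x, pt y} : Set Plane) ⊆ t) :
    t = {pt h, pt x, pt y} := by
  obtain ⟨u, v, hu, hv, h1, h2, h3, rfl⟩ := ht
  have a1 : pt x ∈ ({pt h, pt u, pt v} : Set Plane) := hsub (by simp)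
  have a2 : pt y ∈ ({pt h, pt u, pt v} : Set Plane) := hsub (by simp)
  simp only [Set.mem_insert_iff, Set.mem_singleton_iff, pt_inj] at a1 a2
  obtain rfl : x = u := by omega
  obtain rfl : y = v := by omega
  rfl

lemma isBoundaryEdge_outer {l : List ℕ} {h u v : ℕ} (hu : u ∈ l) (hv : v ∈ l) (h1 : h < u)
    (h2 : u < v) (h3 : ∀ w ∈ l, ¬ (u < w ∧ w < v)) :
    IsBoundaryEdge (fan l h) {pt u, pt v} :=
  ⟨_, ⟨⟨u, v, hu, hv, h1, h2, h3, rfl⟩, by grind⟩,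
    fun _ ⟨ht, hsub⟩ => fan_pair_subset_cases ht h1 h2 hsub⟩

/-- The edge from the centre of the fan to its last point is a boundary edge. -/
lemma isBoundaryEdge_last {l : List ℕ} {h u v : ℕ} (hu : u ∈ l) (hv : v ∈ l) (h1 : h < u)
    (h2 : u < v) (h3 : ∀ w ∈ l, ¬ (u < w ∧ w < v)) (hmax : ∀ w ∈ l, w ≤ v) :
    IsBoundaryEdge (fan l h) {pt h, pt v} := by
  refine ⟨_, ⟨⟨u, v, hu, hv, h1, h2, h3, rfl⟩, by grind⟩, ?_⟩
  rintro _ ⟨⟨u', v', hu', hv', h1', h2', h3', rfl⟩, hsub⟩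
  have a2 : pt v ∈ ({pt h, pt u', pt v'} : Set Plane) := hsub (by simp)
  simp only [Set.mem_insert_iff, Set.mem_singleton_iff, pt_inj] at a2
  have := hmax v' hv'
  obtain rfl : v = v' := by omega
  have := h3 u' hu'
  have := h3' u hu
  obtain rfl : u = u' := by omega
  rfl

/-- An edge `{h, x}` with apices on both sides is not a boundary edge. -/
lemma not_isBoundaryEdge {l : List ℕ} {h u x v : ℕ} (hu : u ∈ l) (hx : x ∈ l) (hv : v ∈ l)
    (h1 : h < u) (h2 : u < x) (h3 : x < v) : ¬ IsBoundaryEdge (fan l h) {pt h, pt x} := by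
  rintro ⟨t, -, huniq⟩
  obtain ⟨a, ha, a1, a2, a3⟩ := exists_pred_mem hu h2
  obtain ⟨b, hb, b1, b2, b3⟩ := exists_succ_mem hv h3
  have e1 := huniq {pt h, pt a, pt x} ⟨⟨a, x, ha, hx, by omega, a1, a3, rfl⟩, by grind⟩
  have e2 := huniq {pt h, pt x, pt b} ⟨⟨x, b, hx, hb, by omega, b1, b3, rfl⟩, by grind⟩
  have := triple_pt_inj (by omega) a1 (by omega) b1 (e1.trans e2.symm)
  omega

lemma chord_sign {a b x : ℕ} (hab : a < b) :
    ((x : ℝ) - a) * (x - b) < 0 ↔ a < x ∧ x < b := by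
  have : (a : ℝ) < b := by exact_mod_cast hab
  rw [mul_neg_iff]
  constructor
  · rintro (⟨h1, h2⟩ | ⟨h1, h2⟩)
    · exact ⟨by exact_mod_cast sub_pos.1 h1, by exact_mod_cast sub_neg.1 h2⟩
    · linarith
  · rintro ⟨h1, h2⟩
    exact Or.inl ⟨sub_pos.2 (by exact_mod_cast h1), sub_neg.2 (by exact_mod_cast h2)⟩

lemma chord_sign_pos {a b x : ℕ} (hab : a < b) :
    0 < ((x : ℝ) - a) * (x - b) ↔ x < a ∨ b < x := by
  have : (a : ℝ) < b := by exact_mod_cast hab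
  rw [mul_pos_iff]
  constructor
  · rintro (⟨h1, h2⟩ | ⟨h1, h2⟩)
    · exact Or.inr (by exact_mod_cast sub_pos.1 h2)
    · exact Or.inl (by exact_mod_cast sub_neg.1 h1)
  · rintro (h | h)
    · have : (x : ℝ) < a := by exact_mod_cast h
      exact Or.inr ⟨by linarith, by linarith⟩
    · have : (b : ℝ) < x := by exact_mod_cast h
      exact Or.inl ⟨by linarith, by linarith⟩

lemma sOppSide_pt_iff_of_lt {a b : ℕ} (hab : a < b) (x y : ℕ) :
    (line[ℝ, pt a, pt b]).SOppSide (pt x) (pt y) ↔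
      ((a < x ∧ x < b) ∧ (y < a ∨ b < y)) ∨ ((x < a ∨ b < x) ∧ (a < y ∧ y < b)) := by
  rw [sOppSide_line_pt_iff hab.ne, mul_neg_iff, chord_sign hab, chord_sign hab,
    chord_sign_pos hab, chord_sign_pos hab, or_comm]

/-- Joining a point of the parabola to a fan adds the triangles over the visible edges. -/
lemma mem_joinPoint_fan_iff {l : List ℕ} {h p : ℕ} (hh : h ∈ l) (hpl : p ∉ l)
    (s : Set Plane) : s ∈ joinPoint (fan l h) (pt p) ↔ s ∈ fan l h ∨
      ∃ a b c, ({a, b, c} : Set Plane) ∈ fan l h ∧ s = {pt p, a, b} ∧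
        IsBoundaryEdge (fan l h) {a, b} ∧ (line[ℝ, a, b]).SOppSide c (pt p) := by
  have key : ∀ t ∈ fan l h, pt p ∉ convexHull ℝ t := by
    rintro _ ⟨u, v, hu, hv, -, -, -, rfl⟩
    exact pt_notMem_convexHull (fun e => hpl (e ▸ hh)) (fun e => hpl (e ▸ hu))
      (fun e => hpl (e ▸ hv))
  constructor
  · rintro (⟨hs, -⟩ | ⟨a, b, c, habc, rfl, hin | hvis⟩)
    · exact Or.inl hs
    · exact absurd hin (key _ habc)
    · exact Or.inr ⟨a, b, c, habc, rfl, hvis⟩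
  · rintro (hs | ⟨a, b, c, habc, rfl, hvis⟩)
    · exact Or.inl ⟨hs, key s hs⟩
    · exact Or.inr ⟨a, b, c, habc, rfl, Or.inr hvis⟩

/-- The edges of a fan visible from a point beyond its first edge. -/
lemma visible_cases {l : List ℕ} {h p y : ℕ} (hy : y ∈ l) (hhy : h < y) (hyp : y < p)
    (hpl : p ∉ l) {a b c : Plane} (habc : ({a, b, c} : Set Plane) ∈ fan l h)
    (hbd : IsBoundaryEdge (fan l h) {a, b}) (hopp : (line[ℝ, a, b]).SOppSide c (pt p)) :
    (∃ u v, u ∈ l ∧ v ∈ l ∧ h < u ∧ u < p ∧ p < v ∧ (∀ w ∈ l, ¬ (u < w ∧ w < v)) ∧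
      ({a, b} : Set Plane) = {pt u, pt v}) ∨
    (∃ v ∈ l, v < p ∧ (∀ w ∈ l, w ≤ v) ∧ ({a, b} : Set Plane) = {pt h, pt v}) := by
  obtain ⟨u, v, hu, hv, h1, h2, h3, e⟩ := habc
  have hne : ∀ x ∈ l, x ≠ p := fun x hx e => hpl (e ▸ hx)
  rcases triple_eq_cases (by simp; omega) (by simp; omega) (by simp; omega) e with
    ⟨rfl, e'⟩ | ⟨rfl, e'⟩ | ⟨rfl, e'⟩
  · rw [e', sOppSide_pt_iff_of_lt h2] at hopp
    exact Or.inl ⟨u, v, hu, hv, h1, by omega, by omega, h3, e'⟩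
  · rw [e', sOppSide_pt_iff_of_lt (by omega)] at hopp
    refine Or.inr ⟨v, hv, by omega, fun w hw => ?_, e'⟩
    by_contra! hlt
    exact not_isBoundaryEdge hu hv hw h1 h2 hlt (e' ▸ hbd)
  -- Here `p` would lie between `h` and `u`; then so does `y`, and the spoke to `u` has triangles on
  -- both sides.
  · rw [e', sOppSide_pt_iff_of_lt h1] at hopp
    exact absurd (e' ▸ hbd) (not_isBoundaryEdge hy hu hv hhy (by omega) h2)

/-- Appending a new last point on the parabola requires no flips. -/
lemma joinPoint_of_forall_lt {l : List ℕ} {h p y z : ℕ} (hh : h ∈ l)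
    (hy : y ∈ l) (hz : z ∈ l) (hhy : h < y) (hyz : y < z) (hp : ∀ x ∈ l, x < p) :
    joinPoint (fan l h) (pt p) = fan (l ++ [p]) h := by
  have hpl : p ∉ l := fun e => (hp p e).false
  obtain ⟨M, hM, hMp, -, hMn⟩ := exists_pred_mem hz (hp z hz)
  have hmax : ∀ w ∈ l, w ≤ M := fun w hw => by
    have := hMn w hw
    have := hp w hw
    omega
  have := hmax z hz
  obtain ⟨u, hu, h1, h2, h3⟩ := exists_pred_mem (x := M) hy (by omega)
  ext s
  rw [mem_joinPoint_fan_iff hh hpl]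
  constructor
  · rintro (⟨u, v, hu, hv, a1, a2, a3, rfl⟩ | ⟨a, b, c, habc, rfl, hbd, hopp⟩)
    · refine ⟨u, v, by simp [hu], by simp [hv], a1, a2, ?_, rfl⟩
      simp only [List.mem_append, List.mem_singleton]
      rintro w (hw | rfl)
      · exact a3 w hw
      · have := hp v hv
        omega
    · rcases visible_cases hy hhy (hp y hy) hpl habc hbd hopp with
        ⟨u, v, hu, hv, -, -, a3, -⟩ | ⟨v, hv, -, hvmax, e⟩
      · have := hp v hv
        omega
      · have := hvmax z hz
        refine ⟨v, p, by simp [hv], by simp, by omega, hp v hv, ?_, ?_⟩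
        · simp only [List.mem_append, List.mem_singleton]
          rintro w (hw | rfl)
          · have := hvmax w hw
            omega
          · omega
        · rw [e]
          grind
  · rintro ⟨a, b, ha, hb, a1, a2, a3, rfl⟩
    simp only [List.mem_append, List.mem_singleton] at ha hb a3
    rcases hb with hb | rfl
    · have := hp b hb
      refine Or.inl ⟨a, b, by grind, hb, a1, a2, fun w hw => a3 w (Or.inl hw), rfl⟩
    · have haM : a = M := by
        have := a3 M (Or.inl hM)
        have : a ∈ l := by grind
        have := hmax a this
        omega
      subst haM
      refine Or.inr ⟨pt h, pt a, pt u, ⟨u, a, hu, hM, by omega, h1, h3, by grind⟩, by grind,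
        isBoundaryEdge_last hu hM (by omega) h1 h3 hmax, ?_⟩
      rw [sOppSide_pt_iff_of_lt (by omega)]
      omega

/-- Inserting a point on the parabola between two others requires one flip. -/
lemma flip_joinPoint_of_lt {l : List ℕ} {h p y z : ℕ} (hh : h ∈ l) (h0 : 0 < h)
    (hy : y ∈ l) (hz : z ∈ l) (hhy : h < y) (hyp : y < p) (hpz : p < z) (hpl : p ∉ l) :
    Flip (joinPoint (fan l h) (pt p)) (fan (l ++ [p]) h) := by
  have hne : ∀ x ∈ l, x ≠ p := fun x hx e => hpl (e ▸ hx)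
  obtain ⟨u, hu, u1, u2, u3⟩ := exists_pred_mem hy hyp
  obtain ⟨v, hv, v1, v2, v3⟩ := exists_succ_mem hz hpz
  have huv : ∀ w ∈ l, ¬ (u < w ∧ w < v) := fun w hw => by
    have := u3 w hw
    have := v3 w hw
    have := hne w hw
    omega
  have hjoin : joinPoint (fan l h) (pt p) = fan l h ∪ {{pt p, pt u, pt v}} := by
    ext s
    rw [mem_joinPoint_fan_iff hh hpl, Set.mem_union, Set.mem_singleton_iff]
    refine or_congr_right ⟨?_, ?_⟩
    · rintro ⟨a, b, c, habc, rfl, hbd, hopp⟩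
      rcases visible_cases hy hhy hyp hpl habc hbd hopp with
        ⟨u', v', hu', hv', -, b1, b2, b3, e⟩ | ⟨v, hv, hvp, hvmax, e⟩
      · have := huv u' hu'
        have := huv v' hv'
        have := b3 u hu
        have := b3 v hv
        obtain rfl : u = u' := by omega
        obtain rfl : v = v' := by omega
        rw [e]
      · have := hvmax z hz
        omega
    · rintro rfl
      refine ⟨pt u, pt v, pt h, ⟨u, v, hu, hv, by omega, by omega, huv, by grind⟩, rfl,
        isBoundaryEdge_outer hu hv (by omega) (by omega) huv, ?_⟩
      rw [sOppSide_pt_iff_of_lt (by omega)]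
      omega
  -- The outer edge below `p` is exchanged for the new spoke from `h` to `p`.
  refine ⟨pt u, pt v, pt h, pt p, by simp; omega, ?_, ?_, ?_, ?_⟩
  · rw [hjoin]
    exact Or.inl ⟨u, v, hu, hv, by omega, by omega, huv, by grind⟩
  · rw [hjoin]
    exact Or.inr (by rw [Set.mem_singleton_iff]; grind)
  · rw [show ({pt u, pt v, pt h} : Set Plane) = {pt h, pt u, pt v} by grind,
      inCircumcircle_pt_of_lt h0 (by omega) (by omega)]
    omega
  · rw [hjoin]
    ext s
    simp only [Set.mem_union, Set.mem_sdiff, Set.mem_insert_iff, Set.mem_singleton_iff, not_or]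
    constructor
    · rintro ⟨a, b, ha, hb, a1, a2, a3, rfl⟩
      simp only [List.mem_append, List.mem_singleton] at ha hb a3
      rcases ha with ha | rfl
      · rcases hb with hb | rfl
        · refine Or.inl ⟨Or.inl ⟨a, b, ha, hb, a1, a2, fun w hw => a3 w (Or.inl hw), rfl⟩, ?_, ?_⟩
          · intro e
            have := triple_pt_inj a1 a2 (u' := u) (v' := v) (by omega) (by omega)
              (by rw [e]; grind)
            have := a3 p (Or.inr rfl)
            omega
          · intro e
            have : pt p ∈ ({pt h, pt a, pt b} : Set Plane) := by rw [e]; simp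
            simp only [Set.mem_insert_iff, Set.mem_singleton_iff, pt_inj] at this
            have := hne a ha
            have := hne b hb
            have := hne h hh
            omega
        · obtain rfl : a = u := by
            have := u3 a ha
            have := a3 u (Or.inl hu)
            omega
          exact Or.inr (Or.inl (by grind))
      · rcases hb with hb | rfl
        · obtain rfl : b = v := by
            have := v3 b hb
            have := a3 v (Or.inl hv)
            omega
          exact Or.inr (Or.inr (by grind))
        · omega
    · rintro (⟨⟨a, b, ha, hb, a1, a2, a3, rfl⟩ | rfl, n1, n2⟩ | rfl | rfl)
      · refine ⟨a, b, by simp [ha], by simp [hb], a1, a2, ?_, rfl⟩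
        simp only [List.mem_append, List.mem_singleton]
        rintro w (hw | rfl)
        · exact a3 w hw
        · rintro ⟨c1, c2⟩
          have := huv a ha
          have := huv b hb
          have := a3 u hu
          have := a3 v hv
          obtain rfl : a = u := by omega
          obtain rfl : b = v := by omega
          exact n1 (by grind)
      · exact absurd (by grind) n2
      · refine ⟨u, p, by simp [hu], by simp, by omega, u1, ?_, by grind⟩
        simp only [List.mem_append, List.mem_singleton]
        rintro w (hw | rfl)
        · exact u3 w hw
        · omega
      · refine ⟨p, v, by simp, by simp [hv], by omega, v1, ?_, by grind⟩
        simp only [List.mem_append, List.mem_singleton]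
        rintro w (hw | rfl)
        · exact v3 w hw
        · omega

/-! ### Executions of the algorithm and their total cost. -/

/-- The first `n` points of the sequence on the parabola with abscissas `v 0, v 1, …`. -/
noncomputable def run (v : ℕ → ℕ) (n : ℕ) : List Plane := ((List.range n).map v).map pt

@[simp] lemma length_run (v : ℕ → ℕ) (n : ℕ) : (run v n).length = n := by simp [run]

lemma run_succ (v : ℕ → ℕ) (n : ℕ) : run v (n + 1) = run v n ++ [pt (v n)] := by
  simp [run, List.range_succ]

lemma run_add (v : ℕ → ℕ) (a b : ℕ) :
    run v (a + b) = run v a ++ run (fun i => v (a + i)) b := by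
  simp [run, List.range_add, Function.comp_def]

lemma take_run (v : ℕ → ℕ) {j n : ℕ} (h : j ≤ n) : (run v n).take j = run v j := by
  obtain ⟨b, rfl⟩ := Nat.exists_eq_add_of_le h
  rw [run_add, List.take_left' (length_run v j)]

lemma drop_run (v : ℕ → ℕ) {j n : ℕ} (h : j ≤ n) :
    (run v n).drop j = run (fun i => v (j + i)) (n - j) := by
  obtain ⟨b, rfl⟩ := Nat.exists_eq_add_of_le h
  rw [run_add, List.drop_left' (length_run v j), Nat.add_sub_cancel_left]

lemma getLast?_run (v : ℕ → ℕ) {n : ℕ} (h : 0 < n) : (run v n).getLast? = some (pt (v (n - 1))) := by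
  obtain ⟨n, rfl⟩ : ∃ m, n = m + 1 := ⟨n - 1, by omega⟩
  simp [run_succ]

lemma inGeneralPosition_run {v : ℕ → ℕ} {n : ℕ} (hpos : ∀ i < n, 0 < v i)
    (hinj : ∀ i < n, ∀ j < n, v i = v j → i = j) : InGeneralPosition (run v n) := by
  refine inGeneralPosition_map_pt ?_ ?_
  · refine List.Nodup.map_on ?_ List.nodup_range
    simpa using hinj
  · simpa using hpos

lemma Exec.of_append {P : List Plane} {p : Plane} {m : ℕ} (h : Exec (P ++ [p]) m) :
    ∃ m' r, Exec P m' ∧ InsertOps P p r ∧ m = m' + r := by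
  generalize hS : P ++ [p] = S at h
  cases h with
  | nil => simp at hS
  | snoc h1 h2 =>
    obtain ⟨rfl, e⟩ := List.append_inj' hS rfl
    obtain rfl := List.singleton_inj.1 e
    exact ⟨_, _, h1, h2, rfl⟩

lemma amortizedDLinear_run {k n : ℕ} {v : ℕ → ℕ} :
    AmortizedDLinear k (run v n) ↔ ∀ i ≤ n, ∃ m ≤ k * i, Exec (run v i) m := by
  simp only [AmortizedDLinear, length_run]
  exact forall₂_congr fun i hi => by rw [take_run v hi]

lemma AmortizedDLinear.of_le {k n j : ℕ} {v : ℕ → ℕ} (h : AmortizedDLinear k (run v n))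
    (hj : j ≤ n) : AmortizedDLinear k (run v j) := by
  rw [amortizedDLinear_run] at h ⊢
  exact fun i hi => h i (hi.trans hj)

/-- Every execution is bounded, because linearity only asks that some execution be cheap. -/
lemma exec_run_lower {v : ℕ → ℕ} {a r : ℕ} (j : ℕ)
    (h : ∀ i, a ≤ i → i < j → ∀ r', InsertOps (run v i) (pt (v i)) r' → r ≤ r') :
    ∀ m, Exec (run v j) m → r * (j - a) ≤ m := by
  induction j with
  | zero => simp
  | succ j ih =>
    intro m hm
    rw [run_succ] at hm
    obtain ⟨m', r', h1, h2, rfl⟩ := hm.of_append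
    have := ih (fun i hi hij => h i hi (by omega)) m' h1
    rcases le_or_gt a j with haj | haj
    · have := h j haj (by omega) r' h2
      rw [Nat.succ_sub haj, Nat.mul_succ]
      omega
    · rw [Nat.sub_eq_zero_of_le haj]
      omega

lemma exec_run_upper {v : ℕ → ℕ} {a r : ℕ} (j : ℕ)
    (h0 : ∀ i, i < j → i < a → InsertOps (run v i) (pt (v i)) 0)
    (h : ∀ i, a ≤ i → i < j → ∃ r' ≤ r, InsertOps (run v i) (pt (v i)) r') :
    ∃ m ≤ r * (j - a), Exec (run v j) m := by
  induction j with
  | zero => exact ⟨0, by simp, Exec.nil⟩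
  | succ j ih =>
    obtain ⟨m, hm, he⟩ := ih (fun i hi => h0 i (by omega)) (fun i hi hij => h i hi (by omega))
    rw [run_succ]
    rcases le_or_gt a j with haj | haj
    · obtain ⟨r', hr', hi⟩ := h j haj (by omega)
      refine ⟨m + r', ?_, he.snoc hi⟩
      rw [Nat.succ_sub haj, Nat.mul_succ]
      omega
    · refine ⟨m + 0, hm.trans (Nat.mul_le_mul_left _ (by omega)), he.snoc (h0 j (by omega) haj)⟩

lemma not_amortizedDLinear_run {k j a r : ℕ} {v : ℕ → ℕ}
    (h : ∀ i, a ≤ i → i < j → ∀ r', InsertOps (run v i) (pt (v i)) r' → r ≤ r')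
    (hlt : k * j < r * (j - a)) : ¬ AmortizedDLinear k (run v j) := by
  intro hl
  obtain ⟨m, hm, he⟩ := amortizedDLinear_run.1 hl j le_rfl
  have := exec_run_lower j h m he
  omega

/-- The cost of an insertion is at least the number of points between the last two points. -/
lemma card_le_of_insertOps {v : ℕ → ℕ} {i r : ℕ} (hi : 3 ≤ i) (hpos : ∀ s < i, 0 < v s)
    (hz : ∃ z < i, v z < v (i - 1) ∧ v z < v i) (I : Finset ℕ)
    (hinj : Set.InjOn v I)
    (hI : ∀ s ∈ I, s < i ∧ min (v (i - 1)) (v i) < v s ∧ v s < max (v (i - 1)) (v i))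
    (h : InsertOps (run v i) (pt (v i)) r) : I.card ≤ r := by
  rcases h with ⟨h, -⟩ | ⟨-, q, f, hq, -, rfl⟩
  · simp at h
    omega
  · rw [getLast?_run v (by omega), Option.some.injEq] at hq
    subst hq
    obtain ⟨z, hz, hz1, hz2⟩ := hz
    -- The apex is the leftmost point present; `hz` puts it left of both ends of the walk, so all
    -- intermediate spokes are crossed.
    obtain ⟨x, hx, hmin⟩ := (Finset.range i).exists_min_image v ⟨0, by simp; omega⟩
    simp only [Finset.mem_range] at hx hmin
    have := hmin z hz
    rw [run, delaunay_map_pt (h := v x) (by simp; exact ⟨x, hx, rfl⟩) (by simpa using hmin)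
      (hpos x hx), ← Finset.card_image_of_injOn hinj]
    refine (card_between_le_ncard_crossedEdges ?_ (by omega) (by omega) _ ?_).trans
      (Nat.le_add_right _ _)
    · simp
      exact ⟨i - 1, by omega, rfl⟩
    · simp only [Finset.mem_image]
      rintro _ ⟨s, hs, rfl⟩
      obtain ⟨h1, h2, h3⟩ := hI s hs
      exact ⟨by simp; exact ⟨s, h1, rfl⟩, h2, h3⟩

lemma ncard_crossedEdges_run_le {v : ℕ → ℕ} {i : ℕ} (hi : 3 ≤ i) (h0 : 0 < v 0)
    (hmin : ∀ s < i, v 0 ≤ v s) (hnew : ∀ s < i, v s ≠ v i) (hp : v 0 < v i) (B : Finset ℕ)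
    (hB : ∀ s < i, min (v (i - 1)) (v i) < v s → v s < max (v (i - 1)) (v i) → v s ∈ B) :
    (crossedEdges (delaunay (run v i)) (pt (v (i - 1))) (pt (v i))).ncard ≤ 2 * B.card := by
  rw [run, delaunay_map_pt (h := v 0) (by simp; exact ⟨0, by omega, rfl⟩) (by simpa using hmin) h0]
  refine ncard_crossedEdges_le (by simpa using hmin) ?_ (by simpa using hnew) hp B
    (by simpa using hB)
  simp
  exact ⟨i - 1, by omega, rfl⟩

lemma insertOps_of_lt_three {v : ℕ → ℕ} {i : ℕ} (hi : i < 3) :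
    InsertOps (run v i) (pt (v i)) 0 :=
  Or.inl ⟨by simpa using hi, rfl⟩

/-- Appending a point beyond all others right after the last of them is free. -/
lemma insertOps_increasing {v : ℕ → ℕ} {i : ℕ} (h0 : 0 < v 0)
    (hv : ∀ s t, s < t → t ≤ i → v s < v t) : InsertOps (run v i) (pt (v i)) 0 := by
  rcases lt_or_ge i 3 with hi | hi
  · exact insertOps_of_lt_three hi
  have hle : ∀ s t, s ≤ t → t ≤ i → v s ≤ v t := fun s t hst ht => by
    rcases hst.eq_or_lt with rfl | hst
    · exact le_rfl
    · exact (hv s t hst ht).le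
  have hcross := ncard_crossedEdges_run_le (v := v) hi h0 (fun s hs => hle 0 s (by omega) hs.le)
    (fun s hs => (hv s i hs le_rfl).ne) (hv 0 i (by omega) le_rfl) ∅ (fun s hs h1 h2 => by
      have := hle s (i - 1) (by omega) (by omega)
      have := hv s i hs le_rfl
      omega)
  refine Or.inr ⟨by simpa using hi, _, 0, getLast?_run v (by omega), ?_, (Nat.le_zero.1 (by simpa using hcross)).symm⟩
  have mem : ∀ s < i, v s ∈ (List.range i).map v := fun s hs => by simp; exact ⟨s, hs, rfl⟩
  rw [← run_succ]
  have e1 : delaunay (run v i) = fan ((List.range i).map v) (v 0) :=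
    delaunay_map_pt (mem 0 (by omega)) (by simpa using fun s hs => hle 0 s (by omega) (le_of_lt hs))
      h0
  have e2 : delaunay (run v (i + 1)) = fan ((List.range i).map v ++ [v i]) (v 0) := by
    rw [run, List.range_succ, List.map_append, List.map_singleton]
    exact delaunay_map_pt (by simp; exact Or.inl ⟨0, by omega, rfl⟩)
      (by
        simp only [List.mem_append, List.mem_map, List.mem_range, List.mem_singleton]
        rintro x (⟨s, hs, rfl⟩ | rfl)
        · exact hle 0 s (by omega) hs.le
        · exact hle 0 i (by omega) le_rfl)
      h0
  rw [e1, e2, joinPoint_of_forall_lt (y := v 1) (z := v 2) (mem 0 (by omega)) (mem 1 (by omega))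
    (mem 2 (by omega)) (hv _ _ (by omega) (by omega)) (hv _ _ (by omega) (by omega))
    (by simpa using fun s hs => hv s i hs le_rfl)]
  exact FlipSeq.refl _

/-- Inserting a point beyond the second smallest one takes at most one flip, and crosses at most
twice as many edges as there are points on the way. -/
lemma exists_insertOps_le {v : ℕ → ℕ} {i : ℕ} (hi : 3 ≤ i) (h0 : 0 < v 0)
    (hmin : ∀ s < i, v 0 ≤ v s) (hnew : ∀ s < i, v s ≠ v i)
    (hy : ∃ y < i, v 0 < v y ∧ v y < v i) (hz : ∃ y < i, ∃ z < i,
      v 0 < v y ∧ v y < v z) (B : Finset ℕ)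
    (hB : ∀ s < i, min (v (i - 1)) (v i) < v s → v s < max (v (i - 1)) (v i) → v s ∈ B) :
    ∃ r ≤ 2 * B.card + 1, InsertOps (run v i) (pt (v i)) r := by
  obtain ⟨y, hyi, hy1, hy2⟩ := hy
  have hcross := ncard_crossedEdges_run_le hi h0 hmin hnew (hy1.trans hy2) B hB
  have mem : ∀ s < i, v s ∈ (List.range i).map v := fun s hs => by simp; exact ⟨s, hs, rfl⟩
  have e1 : delaunay (run v i) = fan ((List.range i).map v) (v 0) :=
    delaunay_map_pt (mem 0 (by omega)) (by simpa using hmin) h0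
  have e2 : delaunay (run v (i + 1)) = fan ((List.range i).map v ++ [v i]) (v 0) := by
    rw [run, List.range_succ, List.map_append, List.map_singleton]
    exact delaunay_map_pt (by simp; exact Or.inl ⟨0, by omega, rfl⟩)
      (by
        simp only [List.mem_append, List.mem_map, List.mem_range, List.mem_singleton]
        rintro x (⟨s, hs, rfl⟩ | rfl)
        · exact hmin s hs
        · exact (hy1.trans hy2).le)
      h0
  obtain ⟨f, hf, hseq⟩ : ∃ f ≤ 1, FlipSeq (joinPoint (delaunay (run v i)) (pt (v i))) f
      (delaunay (run v i ++ [pt (v i)])) := by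
    rw [← run_succ, e1, e2]
    by_cases hmax : ∀ s < i, v s < v i
    · obtain ⟨y', hy', z, hzi, h1, h2⟩ := hz
      refine ⟨0, zero_le_one, ?_⟩
      rw [joinPoint_of_forall_lt (mem 0 (by omega)) (mem y' hy') (mem z hzi) h1 h2
        (by simpa using hmax)]
      exact FlipSeq.refl _
    · push Not at hmax
      obtain ⟨z, hzi, hz⟩ := hmax
      exact ⟨1, le_rfl, FlipSeq.step (flip_joinPoint_of_lt (mem 0 (by omega)) h0 (mem y hyi)
        (mem z hzi) hy1 hy2 (lt_of_le_of_ne hz (hnew z hzi).symm) (by simpa using hnew))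
        (FlipSeq.refl _)⟩
  exact ⟨_, by omega, Or.inr ⟨by simpa using hi, _, f, getLast?_run v (by omega), hseq, rfl⟩⟩

/-! ### Counting the runs of test and divide. -/

/-- A sequence is partitioned into at least one run per `L` points if no block of `L` points is
a run. -/
lemma le_length_testAndDivide {k L : ℕ} (hL : 2 ≤ L) (n : ℕ) : ∀ v : ℕ → ℕ,
    (∀ s l, s + l ≤ n → L ≤ l → ¬ AmortizedDLinear k (run (fun i => v (s + i)) l)) →
    n ≤ L * (testAndDivide k (run v n)).length := by
  induction n using Nat.strong_induction_on with
  | _ n ih =>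
    intro v h
    rw [testAndDivide]
    split_ifs with hc
    · have : ¬ L ≤ n := fun hn => by
        have := h 0 n (by omega) hn
        simp only [Nat.zero_add, length_run] at this hc
        rcases hc with hc | hc
        · exact this hc
        · omega
      simp
      omega
    · rw [length_run] at hc ⊢
      push Not at hc
      have h2 := hc.2
      have a1 := ih (n / 2) (by omega) v fun s l hs hl => h s l (by omega) hl
      have a2 := ih (n - n / 2) (by omega) (fun i => v (n / 2 + i)) fun s l hs hl => by
        have := h (n / 2 + s) l (by omega) hl
        simpa only [Nat.add_assoc] using this
      rw [take_run v (by omega), drop_run v (by omega), List.length_append, Nat.mul_add]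
      omega

/-- A final segment of a sequence none of whose long blocks is a run is partitioned finely, provided
that no long final segment of the whole sequence is a run. -/
lemma le_length_testAndDivide_of_suffix {k L : ℕ} (hL : 2 ≤ L) (n : ℕ) : ∀ (v : ℕ → ℕ) (N : ℕ),
    (∀ s l, N ≤ s → s + l ≤ n → L ≤ l → ¬ AmortizedDLinear k (run (fun i => v (s + i)) l)) →
    (∀ s l, s + l = n → L ≤ l → ¬ AmortizedDLinear k (run (fun i => v (s + i)) l)) →
    n - N ≤ 2 * L * (testAndDivide k (run v n)).length := by
  induction n using Nat.strong_induction_on with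
  | _ n ih =>
    intro v N h hsuf
    rw [testAndDivide]
    split_ifs with hc
    · have : ¬ L ≤ n := fun hn => by
        have := hsuf 0 n (by omega) hn
        simp only [Nat.zero_add, length_run] at this hc
        rcases hc with hc | hc
        · exact this hc
        · omega
      simp
      omega
    · rw [length_run] at hc ⊢
      push Not at hc
      have h2 := hc.2
      rw [take_run v (by omega), drop_run v (by omega), List.length_append, Nat.mul_add]
      -- The runs of the left half are discarded.
      refine le_trans ?_ (Nat.le_add_left _ _)
      -- If the right half lies beyond `N`, it has at least half of the `n - N` points, whence the
      -- factor 2; otherwise it contains all of them and the recursion continues there.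
      rcases le_or_gt N (n / 2) with hN | hN
      · have a2 := le_length_testAndDivide (k := k) hL (n - n / 2) (fun i => v (n / 2 + i))
          fun s l hs hl => by
            have := h (n / 2 + s) l (by omega) (by omega) hl
            simpa only [Nat.add_assoc] using this
        rw [Nat.mul_assoc]
        omega
      · have a2 := ih (n - n / 2) (by omega) (fun i => v (n / 2 + i)) (N - n / 2)
          (fun s l hs hsl hl => by
            have := h (n / 2 + s) l (by omega) (by omega) hl
            simpa only [Nat.add_assoc] using this)
          (fun s l hsl hl => by
            have := hsuf (n / 2 + s) l (by omega) hl
            simpa only [Nat.add_assoc] using this)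
        omega

lemma length_testAndDivide_le (k n : ℕ) : ∀ v : ℕ → ℕ,
    (testAndDivide k (run v n)).length ≤ max 1 n := by
  induction n using Nat.strong_induction_on with
  | _ n ih =>
    intro v
    rw [testAndDivide]
    split_ifs with hc
    · simp
    · rw [length_run] at hc ⊢
      push Not at hc
      have h2 := hc.2
      have a1 := ih (n / 2) (by omega) v
      have a2 := ih (n - n / 2) (by omega) (fun i => v (n / 2 + i))
      rw [take_run v (by omega), drop_run v (by omega), List.length_append]
      omega

/-! ### The hard sequence and its blocks. -/

/-- The abscissas of the hard sequence. The first `N` points increase; the next `K - N` points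
jump back and forth over a distance of about `2 * m`; the remaining `c` points alternate between the
far left and the far right of all the others, moving inwards. -/
def hardSeq (m c N K H t : ℕ) : ℕ :=
  if t < K then
    if N ≤ t ∧ t % 2 = 1 then t + 2 * m + c + 1 else t + c + 1
  else
    if (t - K) % 2 = 0 then t - K + 1 else H - (t - K)

section

variable {k m c N K H : ℕ}

lemma hardSeq_of_lt {t : ℕ} (h : t < K) : hardSeq m c N K H t =
    if N ≤ t ∧ t % 2 = 1 then t + 2 * m + c + 1 else t + c + 1 := if_pos h

lemma hardSeq_add (j : ℕ) : hardSeq m c N K H (K + j) =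
    if j % 2 = 0 then j + 1 else H - j := by
  simp [hardSeq]

lemma hardSeq_pos (hH : K + 2 * m + 2 * c + 2 ≤ H) {t : ℕ} (ht : t < K + c) :
    0 < hardSeq m c N K H t := by
  rw [hardSeq]
  split_ifs <;> omega

/-- The offset `c + 1` leaves room for the left points and `H` for the right ones. The jump `2 * m`
is even, so raised and unraised points keep abscissas of different parity in the zigzag. -/
lemma hardSeq_inj (hH : K + 2 * m + 2 * c + 2 ≤ H) {s t : ℕ} (hs : s < K + c)
    (ht : t < K + c) (h : hardSeq m c N K H s = hardSeq m c N K H t) : s = t := by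
  rw [hardSeq, hardSeq] at h
  split_ifs at h <;> omega

/-- Consecutive zigzag abscissas differ by at most `2 * m + 1`, so at most `2 * m` points lie
between: at most `4 * m` crossings and one flip. The `N` free insertions pay for this. -/
lemma amortizedDLinear_hardSeq_left (hN : 3 ≤ N)
    (hk : (4 * m + 1) * (K - N) ≤ k * N) :
    AmortizedDLinear k (run (hardSeq m c N K H) K) := by
  rw [amortizedDLinear_run]
  intro j hj
  have hv : ∀ t < j, hardSeq m c N K H t =
      if N ≤ t ∧ t % 2 = 1 then t + 2 * m + c + 1 else t + c + 1 :=
    fun t ht => hardSeq_of_lt (by omega)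
  generalize hardSeq m c N K H = v at hv
  obtain ⟨M, hM, he⟩ := exec_run_upper (v := v) (a := N) (r := 4 * m + 1) j
    (fun i hi hiN => insertOps_increasing
      (by rw [hv 0 (by omega)]; split_ifs <;> omega)
      (fun s t hst ht => by
        rw [hv s (by omega), hv t (by omega), if_neg (by omega), if_neg (by omega)]
        omega))
    (fun i hi hij => by
      have v0 : v 0 = c + 1 := by rw [hv 0 (by omega), if_neg (by omega)]; omega
      have v1 : v 1 = c + 2 := by rw [hv 1 (by omega), if_neg (by omega)]; omega
      have v2 : v 2 = c + 3 := by rw [hv 2 (by omega), if_neg (by omega)]; omega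
      have vi := hv i hij
      have vi' := hv (i - 1) (by omega)
      obtain ⟨r, hr, h⟩ := exists_insertOps_le (v := v) (i := i) (by omega) (by omega)
        (fun s hs => by rw [v0, hv s (by omega)]; split_ifs <;> omega)
        (fun s hs => by rw [vi, hv s (by omega)]; split_ifs <;> omega)
        ⟨1, by omega, by omega, by rw [vi]; split_ifs <;> omega⟩
        ⟨1, by omega, 2, by omega, by omega, by omega⟩
        (Finset.Ioo (min (v (i - 1)) (v i)) (max (v (i - 1)) (v i)))
        (fun s hs h1 h2 => Finset.mem_Ioo.2 ⟨h1, h2⟩)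
      refine ⟨r, hr.trans ?_, h⟩
      rw [Nat.card_Ioo]
      split_ifs at vi vi' <;> omega)
  refine ⟨M, hM.trans ?_, he⟩
  rcases le_or_gt j N with hjN | hjN
  · simp [Nat.sub_eq_zero_of_le hjN]
  · calc (4 * m + 1) * (j - N) ≤ (4 * m + 1) * (K - N) := by gcongr
      _ ≤ k * N := hk
      _ ≤ k * j := by gcongr

/-- As the points move inwards, none lies between two successive ones: there are no crossings, only
at most one flip each. -/
lemma amortizedDLinear_hardSeq_right (hk : 0 < k) (hH : 2 * c + 2 ≤ H) :
    AmortizedDLinear k (run (fun i => hardSeq m c N K H (K + i)) c) := by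
  rw [amortizedDLinear_run]
  intro j hj
  have hv : ∀ t, hardSeq m c N K H (K + t) = if t % 2 = 0 then t + 1 else H - t :=
    fun t => hardSeq_add t
  simp only [hv]
  set v : ℕ → ℕ := fun t => if t % 2 = 0 then t + 1 else H - t with hvdef
  replace hv : ∀ t, v t = if t % 2 = 0 then t + 1 else H - t := fun t => rfl
  clear_value v
  have v0 : v 0 = 1 := by rw [hv]; rfl
  have v1 : v 1 = H - 1 := by rw [hv]; rfl
  have v2 : v 2 = 3 := by rw [hv]; rfl
  obtain ⟨M, hM, he⟩ := exec_run_upper (v := v) (a := 0) (r := 1) j (by simp) (fun i _ hij => by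
    rcases lt_or_ge i 3 with hi | hi
    · exact ⟨0, by omega, insertOps_of_lt_three hi⟩
    have vi := hv i
    have vi' := hv (i - 1)
    obtain ⟨r, hr, h⟩ := exists_insertOps_le (v := v) (i := i) hi (by omega)
        (fun s hs => by rw [v0, hv s]; split_ifs <;> omega)
        (fun s hs => by rw [vi, hv s]; split_ifs <;> omega)
        ⟨2, by omega, by omega, by rw [vi]; split_ifs <;> omega⟩
        ⟨2, by omega, 1, by omega, by omega, by omega⟩ ∅
        (fun s hs h1 h2 => by
          have vs := hv s
          split_ifs at vi vi' vs <;> omega)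
    exact ⟨r, by simpa using hr, h⟩)
  refine ⟨M, hM.trans ?_, he⟩
  exact Nat.mul_le_mul hk (by omega)

lemma not_amortizedDLinear_hardSeq_suffix (hH : K + 2 * m + 2 * c + 2 ≤ H)
    (hc : c = 2 * k + 3) {s : ℕ} (hs : s + c ≤ K) :
    ¬ AmortizedDLinear k (run (fun i => hardSeq m c N K H (s + i)) (K + c - s)) := by
  obtain ⟨A, rfl⟩ := Nat.exists_eq_add_of_le (show s ≤ K by omega)
  have hX : ∀ t < A, c + 1 ≤ hardSeq m c N (s + A) H (s + t) ∧
      hardSeq m c N (s + A) H (s + t) < s + A + 2 * m + c + 1 := fun t ht => by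
    rw [hardSeq_of_lt (by omega)]
    split_ifs <;> omega
  have hY : ∀ j, hardSeq m c N (s + A) H (s + (A + j)) = if j % 2 = 0 then j + 1 else H - j :=
    fun j => by rw [← Nat.add_assoc, hardSeq_add]
  have hpos : ∀ t < A + c, 0 < hardSeq m c N (s + A) H (s + t) :=
    fun t ht => hardSeq_pos hH (by omega)
  have hinj : ∀ t < A, ∀ t' < A, hardSeq m c N (s + A) H (s + t) =
      hardSeq m c N (s + A) H (s + t') → t = t' := fun t ht t' ht' h => by
    have := hardSeq_inj hH (by omega) (by omega) h
    omega
  rw [show s + A + c - s = A + c by omega]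
  generalize hw : (fun i => hardSeq m c N (s + A) H (s + i)) = w
  have hw' : ∀ i, hardSeq m c N (s + A) H (s + i) = w i := fun i => by rw [← hw]
  simp only [hw'] at hX hY hpos hinj
  -- The first two alternating points are skipped, so that the point of abscissa 1 is the apex and
  -- the walk joins two outer points. The remaining `2 * k + 1` walks each cross at least `A`
  -- spokes, too many since `A ≥ c`.
  refine not_amortizedDLinear_run (a := A + 2) (r := A) (fun i hi hij r' hr' => ?_) ?_
  · obtain ⟨d, rfl⟩ := Nat.exists_eq_add_of_le (show A ≤ i by omega)
    have e0 := hY 0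
    have e1 := hY (d - 1)
    have e2 := hY d
    rw [← Nat.add_sub_assoc (by omega)] at e1
    have := card_le_of_insertOps (I := Finset.range A) (by omega)
      (fun t ht => hpos t (by omega))
      ⟨A, by omega, by simp at e0; split_ifs at e1 e2 <;> omega⟩
      (fun t ht t' ht' h => hinj t (by simpa using ht) t' (by simpa using ht') h)
      (fun t ht => by
        rw [Finset.mem_range] at ht
        have := hX t ht
        split_ifs at e1 e2 <;> omega) hr'
    simpa using this
  · subst hc
    rw [show A + (2 * k + 3) - (A + 2) = 2 * k + 1 by omega]
    nlinarith

lemma not_amortizedDLinear_hardSeq_block (hk : 0 < k) (hm : m = 2 * k + 1) {s : ℕ}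
    (hNs : N ≤ s) (hs : s + (8 * k + 3) ≤ K) :
    ¬ AmortizedDLinear k (run (fun i => hardSeq m c N K H (s + i)) (8 * k + 3)) := by
  have hv : ∀ t < 8 * k + 3, hardSeq m c N K H (s + t) =
      if (s + t) % 2 = 1 then s + t + 2 * m + c + 1 else s + t + c + 1 := fun t ht => by
    rw [hardSeq_of_lt (by omega)]
    simp only [show N ≤ s + t by omega, true_and]
  generalize hw : (fun i => hardSeq m c N K H (s + i)) = w
  have hw' : ∀ i, hardSeq m c N K H (s + i) = w i := fun i => by rw [← hw]
  simp only [hw'] at hv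
  refine not_amortizedDLinear_run (a := 4 * k + 1) (r := 2 * k) (fun i hi hij r' hr' => ?_) ?_
  · have vi := hv i hij
    have vi' := hv (i - 1) (by omega)
    -- `i - δ` is the raised end of the walk. The `2 * k` raised points before it, at steps of two,
    -- lie between the ends because `m = 2 * k + 1`; indices from `4 * k + 1` on have that many
    -- predecessors.
    obtain ⟨δ, hδ⟩ : ∃ δ, δ = if (s + i) % 2 = 1 then 0 else 1 := ⟨_, rfl⟩
    have hδ1 : δ ≤ 1 := by split_ifs at hδ <;> omega
    have hinj : Set.InjOn (fun d => i - δ - 2 * d) (Finset.Icc 1 (2 * k) : Set ℕ) := by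
      intro x hx y hy e
      simp only [Finset.coe_Icc, Set.mem_Icc] at hx hy e
      omega
    have := card_le_of_insertOps (I := (Finset.Icc 1 (2 * k)).image fun d => i - δ - 2 * d)
      (by omega)
      (fun t ht => by rw [hv t (by omega)]; split_ifs <;> omega)
      -- The first unraised point of the block is its leftmost.
      ⟨s % 2, by omega, by
        rw [hv (s % 2) (by omega)]
        split_ifs at vi vi' ⊢ <;> omega⟩
      (fun t ht t' ht' h => by
        simp only [Finset.coe_image, Set.mem_image, Finset.coe_Icc, Set.mem_Icc] at ht ht'
        obtain ⟨d, hd, rfl⟩ := ht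
        obtain ⟨d', hd', rfl⟩ := ht'
        rw [hv _ (by omega), hv _ (by omega)] at h
        split_ifs at h <;> omega)
      (fun t ht => by
        simp only [Finset.mem_image, Finset.mem_Icc] at ht
        obtain ⟨d, hd, rfl⟩ := ht
        rw [hv (i - δ - 2 * d) (by omega)]
        split_ifs at vi vi' hδ ⊢ <;> omega) hr'
    rw [Finset.card_image_of_injOn hinj] at this
    simpa using this
  -- The total is at least `2 * k * (4 * k + 2)`, which exceeds `k * (8 * k + 3)` by `k`.
  · rw [show 8 * k + 3 - (4 * k + 1) = 4 * k + 2 by omega]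
    nlinarith

/-- A sequence which is the concatenation of two runs, but not a run, has minimum partition
size `2`. -/
lemma isLeast_runPartitionSizes {S X Y : List Plane} (hS : S = X ++ Y) (hX : X ≠ [])
    (hY : Y ≠ []) (hXl : AmortizedDLinear k X) (hYl : AmortizedDLinear k Y)
    (hSl : ¬ AmortizedDLinear k S) : IsLeast (runPartitionSizes k S) 2 := by
  constructor
  · refine ⟨[X, Y], rfl, by simp [hS], ?_⟩
    simp only [List.mem_cons, List.not_mem_nil, or_false]
    rintro R (rfl | rfl)
    exacts [⟨hX, hXl⟩, ⟨hY, hYl⟩]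
  · rintro m ⟨Q, rfl, hQ, hR⟩
    match Q with
    | [] =>
      rw [List.flatten_nil, hS] at hQ
      exact absurd (List.append_eq_nil_iff.1 hQ.symm).1 hX
    | [R] =>
      rw [List.flatten_singleton] at hQ
      exact absurd (hQ ▸ (hR R (by simp)).2) hSl
    | _ :: _ :: _ => simp

end

/-! ### Choice of parameters and conclusion. -/

theorem mainTheorem9 (k : ℕ) (hk : 0 < k) :
    ∃ S : ℕ → List Plane,
      (∀ n, (S n).length = n ∧ InGeneralPosition (S n)) ∧
      ((fun n => ((testAndDivide k (S n)).length : ℝ)) =Θ[atTop] (fun n => (n : ℝ))) ∧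
      (∀ᶠ n in atTop, IsLeast (runPartitionSizes k (S n)) 2) := by
  obtain ⟨m, hm⟩ : ∃ m, m = 2 * k + 1 := ⟨_, rfl⟩
  obtain ⟨c, hc⟩ : ∃ c, c = 2 * k + 3 := ⟨_, rfl⟩
  -- `D` is `4 * m + 2`: a fraction `1 / D` of the points zigzags, leaving at least `4 * m + 1` free
  -- insertions for each.
  obtain ⟨D, hD⟩ : ∃ D, D = 8 * k + 6 := ⟨_, rfl⟩
  -- `L` is `(8 * k + 3) + c`: a block of `L` points beyond `N` starts with `8 * k + 3` zigzag
  -- points, and a final segment of `L` points has at least `c` points before the last phase.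
  obtain ⟨L, hL⟩ : ∃ L, L = 10 * k + 6 := ⟨_, rfl⟩
  set N : ℕ → ℕ := fun n => (n - c) - (n - c) / D with hN
  set v : ℕ → ℕ → ℕ := fun n =>
    hardSeq m c (N n) (n - c) (n + 2 * m + 2 * c + 2) with hv
  have hsuf : ∀ n s l, s + l = n → L ≤ l →
      ¬ AmortizedDLinear k (run (fun i => v n (s + i)) l) := by
    intro n s l hsl hl
    have := not_amortizedDLinear_hardSeq_suffix (N := N n) (K := n - c) (m := m) (c := c) (k := k)
      (H := n + 2 * m + 2 * c + 2) (s := s) (by omega) hc (by omega)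
    rwa [show n - c + c - s = l by omega] at this
  have hblock : ∀ n s l, N n ≤ s → s + l ≤ n → L ≤ l →
      ¬ AmortizedDLinear k (run (fun i => v n (s + i)) l) := by
    intro n s l hNs hsl hl h
    exact not_amortizedDLinear_hardSeq_block hk hm hNs (by omega) (h.of_le (by omega))
  refine ⟨fun n => run (v n) n, fun n => ⟨length_run _ _, inGeneralPosition_run
    (fun i hi => hardSeq_pos (by omega) (by omega))
    (fun i hi j hj h => hardSeq_inj (by omega) (by omega) (by omega) h)⟩, ⟨?_, ?_⟩, ?_⟩
  · refine IsBigO.of_bound 1 ?_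
    filter_upwards [eventually_ge_atTop 1] with n hn
    have := length_testAndDivide_le k n (v n)
    rw [Real.norm_natCast, Real.norm_natCast, one_mul]
    exact_mod_cast this.trans (by omega)
  · refine IsBigO.of_bound (D * (2 * L) : ℕ) ?_
    filter_upwards [eventually_ge_atTop c] with n hn
    have h1 := le_length_testAndDivide_of_suffix (k := k) (L := L) (by omega) n (v n) (N n)
      (hblock n) (hsuf n)
    have h2 : n ≤ D * (n - N n) := by
      have e : n - N n = c + (n - c) / D := by
        have := Nat.div_le_self (n - c) D
        simp only [hN]
        generalize (n - c) / D = g at *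
        omega
      have := Nat.div_add_mod (n - c) D
      have := Nat.mod_lt (n - c) (show 0 < D by omega)
      -- The `c` final points, multiplied by `D`, absorb both the rounding in `(n - c) / D` and the
      -- shift by `c`.
      have : D * 1 + c ≤ D * c := by nlinarith
      have := Nat.sub_add_cancel hn
      rw [e, Nat.mul_add]
      linarith
    rw [Real.norm_natCast, Real.norm_natCast]
    exact_mod_cast h2.trans ((Nat.mul_le_mul_left D h1).trans (Nat.mul_assoc _ _ _).ge)
  · filter_upwards [eventually_ge_atTop (L + c)] with n hn
    have hdiv : D * ((n - c) / D) ≤ n - c := Nat.mul_div_le _ _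
    have hg : (n - c) / D + (8 * k + 5) * ((n - c) / D) ≤ n - c := by
      refine le_trans (le_of_eq ?_) hdiv
      rw [hD]
      ring
    have hNn : (8 * k + 5) * ((n - c) / D) ≤ N n := by
      simp only [hN]
      omega
    refine isLeast_runPartitionSizes (X := run (v n) (n - c))
      (Y := run (fun i => v n (n - c + i)) c) ?_ ?_ ?_ ?_
      (amortizedDLinear_hardSeq_right hk (by omega)) ?_
    · rw [← run_add, Nat.sub_add_cancel (by omega)]
    · exact List.ne_nil_of_length_pos (by rw [length_run]; omega)
    · exact List.ne_nil_of_length_pos (by rw [length_run]; omega)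
    · have hsub : n - c - N n = (n - c) / D := Nat.sub_sub_self (Nat.div_le_self _ _)
      refine amortizedDLinear_hardSeq_left ?_ ?_
      · by_contra! hlt
        -- If no points zigzag, then `N n = n - c`, which is at least `L`.
        have : (n - c) / D = 0 := by
          by_contra h0
          have := Nat.pos_of_ne_zero h0
          nlinarith
        omega
      · rw [hsub, show 4 * m + 1 = 8 * k + 5 by omega]
        exact hNn.trans (Nat.le_mul_of_pos_left _ hk)
    · simpa using hsuf n 0 n (by omega) (by omega)
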